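/- Let $A\in\mathbb{R}^{n\times n}$, $B\in\mathbb{R}^{n\times m}$, and let $Q\in\mathbb{R}^{n\times n}$, $R\in\mathbb{R}^{m\times m}$, $\Sigma\in\mathbb{R}^{n\times n}$ be symmetric positive definite. Let $$\mathcal{S}=\{K\in\mathbb{R}^{m\times n}:\ \text{every complex eigenvalue of } A-BK \text{ has negative real part}\}$$ be the set of stabilizing feedback gains, and for $K\in\mathcal{S}$ let $$f(K)=\mathbb{E}_{x_0}\int_0^\infty\big(x(t)^{\rm T}Qx(t)+u(t)^{\rm T}Ru(t)\big)\,{\rm d}t,\qquad u(t)=-Kx(t),\quad \dot x(t)=(A-BK)x(t),\quad x(0)=x_0,$$ be the SLQR cost, where the random initial state $x_0$ has mean zero and covariance $\mathbb{E}\,x_0x_0^{\rm T}=\Sigma$. Suppose that $\mathcal{S}\neq\emptyset$, let $K_0\in\mathcal{S}$ be arbitrary, and let $\mathcal{S}_1=\{K\in\mathcal{S}: f(K)\le f(K_0)\}$. Gradients are taken with respect to the Frobenius inner product. For parameters $d,\beta$ consider, on $\mathcal{S}\times\mathbb{R}^{m\times n}$, the system $$\dot K=p,\qquad \dot p=-\nabla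 f(K)+f_d(K,p),\qquad f_d(q,p)=-2dp-\big(\nabla f(q+\beta p)-\nabla f(q)\big).$$ Provided that $d>0$ and $\beta=0$, so that the system is the heavy-ball flow $\ddot K+2d\dot K+\nabla f(K)=0$, the following hold. 1. The function $f$ is differentiable on $\mathcal{S}$ and has exactly one stationary point $K^*$ in $\mathcal{S}$, and $f(K^*)\le f(K)$ for all $K\in\mathcal{S}$. 2. For every $z_0\in\mathcal{S}\times\mathbb{R}^{m\times n}$ the system has a unique solution $t\mapsto\varphi_t(z_0)\in\mathcal{S}\times\mathbb{R}^{m\times n}$, $t\in[0,\infty)$, with $\varphi_0(z_0)=z_0$. The point $z^*=(K^*,0)$ is an asymptotically stable equilibrium in the sense of Lyapunov: $\varphi_t(z^*)=z^*$ for all $t\ge 0$, $\varphi_t$ is continuous at $z^*$ uniformly in $t\ge0$, and $\varphi_t(z_0)\to z^*$ as $t\to\infty$ for all $z_0$ in a neighbourhood of $z^*$. 3. The region of attraction $\{z_0:\lim_{t\to\infty}\varphi_t(z_0)=z^*\}$ of $z^*$ contains $\mathcal{S}_1\times\mathbb{R}^{m\times n}$. -/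

import Mathlib

open Set Filter Topology MeasureTheory
open scoped Matrix Gradient

/-! ## The state-feedback linear-quadratic regulator -/

/-- The state `x(t)` at time `t` of the closed loop `x' = (A - B K) x`, `x(0) = x₀`. -/
noncomputable def closedLoopState {n m : ℕ} (A : Matrix (Fin n) (Fin n) ℝ) (B : Matrix (Fin n) (Fin m) ℝ)
    (K : Matrix (Fin m) (Fin n) ℝ) (x₀ : Fin n → ℝ) (t : ℝ) : Fin n → ℝ :=
  NormedSpace.exp (t • (A - B * K)) *ᵥ x₀

/-- The set of stabilizing gains: all complex eigenvalues of `A - B K` have negative real part. -/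
def stabilizingGains {n m : ℕ} (A : Matrix (Fin n) (Fin n) ℝ) (B : Matrix (Fin n) (Fin m) ℝ) :
    Set (Matrix (Fin m) (Fin n) ℝ) :=
  {K | ∀ s ∈ spectrum ℂ ((A - B * K).map (algebraMap ℝ ℂ)), s.re < 0}

/-- `μ` is the law of a random initial state with finite second moments, mean zero and
covariance matrix `Sig`. -/
structure IsInitialLaw {n : ℕ} (μ : Measure (Fin n → ℝ)) (Sig : Matrix (Fin n) (Fin n) ℝ) :
    Prop where
  prob : IsProbabilityMeasure μ
  memLp : ∀ i, MemLp (fun x : Fin n → ℝ => x i) 2 μ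
  mean : ∀ i, ∫ x, x i ∂μ = 0
  cov : ∀ i j, ∫ x, x i * x j ∂μ = Sig i j

/-- The SLQR cost of the gain `K`: the expectation, over the initial state, of
`∫₀^∞ (xᵀ Q x + uᵀ R u) dt` along the closed loop with `u = - K x`. -/
noncomputable def slqrCost {n m : ℕ} (A : Matrix (Fin n) (Fin n) ℝ) (B : Matrix (Fin n) (Fin m) ℝ)
    (Q : Matrix (Fin n) (Fin n) ℝ) (R : Matrix (Fin m) (Fin m) ℝ) (μ : Measure (Fin n → ℝ))
    (K : Matrix (Fin m) (Fin n) ℝ) : ℝ :=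
  ∫ x₀, (∫ t in Ioi (0 : ℝ),
    (closedLoopState A B K x₀ t ⬝ᵥ (Q *ᵥ closedLoopState A B K x₀ t)
      + (-(K *ᵥ closedLoopState A B K x₀ t)) ⬝ᵥ (R *ᵥ (-(K *ᵥ closedLoopState A B K x₀ t))))) ∂μ

/-- The sublevel set of stabilizing gains whose cost is at most that of `K₀`. -/
def slqrSublevel {n m : ℕ} (A : Matrix (Fin n) (Fin n) ℝ) (B : Matrix (Fin n) (Fin m) ℝ)
    (Q : Matrix (Fin n) (Fin n) ℝ) (R : Matrix (Fin m) (Fin m) ℝ) (μ : Measure (Fin n → ℝ))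
    (K₀ : Matrix (Fin m) (Fin n) ℝ) : Set (Matrix (Fin m) (Fin n) ℝ) :=
  {K | K ∈ stabilizingGains A B ∧ slqrCost A B Q R μ K ≤ slqrCost A B Q R μ K₀}

/-! ## The Frobenius inner product on matrices -/

attribute [local instance] Matrix.frobeniusNormedAddCommGroup Matrix.frobeniusNormedSpace

/-- The Frobenius inner product `⟪X, Y⟫ = Tr (Xᵀ Y)`, inducing the Frobenius norm. -/
@[reducible] noncomputable def frobeniusInner (m n : ℕ) : InnerProductSpace ℝ (Matrix (Fin m) (Fin n) ℝ) where
  inner X Y := (Xᵀ * Y).trace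
  norm_sq_eq_re_inner X := by
    rw [Matrix.frobenius_norm_def, ← Real.sqrt_eq_rpow, Real.sq_sqrt (by positivity)]
    simp only [Matrix.trace, Matrix.diag, Matrix.mul_apply, Matrix.transpose_apply, RCLike.re_to_real]
    rw [Finset.sum_comm]
    refine Finset.sum_congr rfl fun i _ => Finset.sum_congr rfl fun j _ => ?_
    simp [pow_two]
  conj_inner_symm X Y := by
    simp only [conj_trivial]
    rw [← Matrix.trace_transpose, Matrix.transpose_mul, Matrix.transpose_transpose]
  add_left X Y Z := by simp [Matrix.add_mul]
  smul_left X Y r := by simp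

attribute [local instance] frobeniusInner

instance frobeniusComplete (m n : ℕ) : CompleteSpace (Matrix (Fin m) (Fin n) ℝ) :=
  FiniteDimensional.complete ℝ _

/-! ## The modified heavy-ball flow -/

/-- The vector field `F(K, p) = (p, -∇f(K) + f_d(K, p))` with
`f_d(q, p) = -2 d p - (∇f(q + β p) - ∇f(q))`; gradients are for the Frobenius inner product. -/
noncomputable def heavyBallField {m n : ℕ} (f : Matrix (Fin m) (Fin n) ℝ → ℝ) (d β : ℝ)
    (z : Matrix (Fin m) (Fin n) ℝ × Matrix (Fin m) (Fin n) ℝ) :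
    Matrix (Fin m) (Fin n) ℝ × Matrix (Fin m) (Fin n) ℝ :=
  (z.2, -∇ f z.1 + (-((2 * d) • z.2) - (∇ f (z.1 + β • z.2) - ∇ f z.1)))

/-- `z` solves `z' = F(z)` on the time interval `s`, staying in the phase space `P`
(one-sided derivatives are taken at the end points that belong to `s`). -/
def IsSolutionOn {E : Type*} [NormedAddCommGroup E] [NormedSpace ℝ E] (F : E → E) (P : Set E)
    (z : ℝ → E) (s : Set ℝ) : Prop :=
  ∀ t ∈ s, z t ∈ P ∧ HasDerivWithinAt z (F (z t)) s t

/-- `φ` is the forward flow of `z' = F(z)` on `P`: for every `z₀ ∈ P`, the curve `t ↦ φ t z₀` is a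
solution on `[0, ∞)` in `P` starting at `z₀`, and every solution on a compact interval `[0, T]`
starting at `z₀` agrees with it. -/
def IsForwardFlow {E : Type*} [NormedAddCommGroup E] [NormedSpace ℝ E] (F : E → E) (P : Set E)
    (φ : ℝ → E → E) : Prop :=
  ∀ z₀ ∈ P, φ 0 z₀ = z₀ ∧ IsSolutionOn F P (fun t => φ t z₀) (Ici 0) ∧
    ∀ (T : ℝ) (w : ℝ → E), 0 ≤ T → w 0 = z₀ → IsSolutionOn F P w (Icc 0 T) →
      ∀ t ∈ Icc 0 T, w t = φ t z₀

/-- `zs` is an asymptotically stable equilibrium, in the sense of Lyapunov, of the forward flow `φ`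
on `P`: it is an interior point of `P` fixed by the flow, `φ t` is continuous at `zs` uniformly in
`t ≥ 0`, and `φ t z₀ → zs` as `t → ∞` for all `z₀` in a neighbourhood of `zs`. -/
def IsLyapunovAsymptoticallyStable {E : Type*} [TopologicalSpace E] (P : Set E) (φ : ℝ → E → E)
    (zs : E) : Prop :=
  P ∈ 𝓝 zs ∧ (∀ t, 0 ≤ t → φ t zs = zs) ∧
    (∀ U ∈ 𝓝 zs, ∃ V ∈ 𝓝 zs, ∀ z₀ ∈ V, ∀ t, 0 ≤ t → φ t z₀ ∈ U) ∧
    (∀ᶠ z₀ in 𝓝 zs, Tendsto (fun t => φ t z₀) atTop (𝓝 zs))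

/-- The region of attraction of `zs` under the forward flow `φ` on `P`. -/
def regionOfAttraction {E : Type*} [TopologicalSpace E] (P : Set E) (φ : ℝ → E → E) (zs : E) :
    Set E :=
  {z₀ | z₀ ∈ P ∧ Tendsto (fun t => φ t z₀) atTop (𝓝 zs)}

/-!
Three facts carry the theorem.

*The cost is a Lyapunov equation.* For a stabilizing gain `K` the exponential of `M = A - B K` decays
(`Matrix.tendsto_exp_smul_of_spectrum`), so the Lyapunov operator `X ↦ Mᵀ X + X M` is invertible, and
the cost is `tr (P Sig)` with `Mᵀ P + P M = -(Q + Kᵀ R K)` (`slqrCost_eq_trace`). Inverting a linear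
operator is smooth, so `P` and the Gramian `Y`, which solves `M Y + Y Mᵀ = -Sig`, are smooth in `K`.
Conversely a positive semidefinite solution `P` certifies that `K` is stabilizing
(`re_neg_of_lyapunov`). Hence a sublevel set of the cost is a projection of the closed set of pairs
`(K, P)` that satisfy the equation and a bound on `tr (P Sig)`; this set is bounded, so the
sublevel sets are compact (`isCompact_slqrCost_sublevel`).

*Stationary points are strict minimizers.* With `G = R K - Bᵀ P` and `E = L - K`, the costs of two
stabilizing gains differ by exactly `tr ((Eᵀ G + Gᵀ E + Eᵀ R E) Y_L)` (`slqrCost_sub_slqrCost`).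
To first order in `E` this says that the gradient at `K` is `2 G Y_K`, so stationarity means `G = 0`,
as `Y_K` is invertible. If `G = 0` the difference is `tr (Eᵀ R E Y_L)`, positive for `L ≠ K`. So
there is at most one stationary point, and by compactness there is a minimizer. Neither convexity
nor uniqueness theory for the Riccati equation is needed.

*The heavy-ball flow.* The energy `V = f K + ‖p‖² / 2` has compact sublevel sets and derivative
`-2 d ‖p‖²`, which gives global solutions and, `V` having a strict minimum at `(K*, 0)`, Lyapunov
stability. On a given sublevel set of `V`, the derivative of `V + ε ⟪∇f K, p⟫` is negative away from
`(K*, 0)` for small `ε`, so `V` cannot level off above its minimum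
(`exists_flow_of_lyapunov`, `exists_heavyBall_flow`). Every solution in the phase space therefore
converges to `(K*, 0)`, whatever its initial cost.
-/

/-! ### Autonomous differential equations on an open set -/

section ODE

variable {E : Type*} [NormedAddCommGroup E] [NormedSpace ℝ E] [FiniteDimensional ℝ E]

/-- A `C¹` field on an open set can be cut off outside a neighbourhood of a compact set, so that
the result is globally `C¹` with compact support. -/
theorem exists_cutoff_field {F : E → E} {P C : Set E} (hP : IsOpen P)
    (hF : ContDiffOn ℝ 1 F P) (hC : IsCompact C) (hCP : C ⊆ P) :
    ∃ χ : E → ℝ, (∀ x, 0 ≤ χ x) ∧ (∀ x ∈ C, χ x = 1) ∧ (∀ x, x ∉ P → χ x = 0) ∧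
      ContDiff ℝ 1 (fun x => χ x • F x) ∧ HasCompactSupport (fun x => χ x • F x) := by
  obtain ⟨D, hD, hCD, hDP⟩ := exists_compact_between hC hP hCP
  obtain ⟨χ, h1, h0, hχ⟩ := exists_contMDiffMap_one_nhds_of_subset_interior
    (modelWithCornersSelf ℝ E) hC.isClosed hCD (n := 1)
  refine ⟨χ, fun x => (hχ x).1, fun x hx => h1.self_of_nhdsSet x hx,
    fun x hx => h0 x fun h => hx (hDP h), ?_, ?_⟩
  · refine contDiff_iff_contDiffAt.2 fun x => ?_
    by_cases hx : x ∈ P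
    · exact χ.contMDiff.contDiff.contDiffAt.smul (hF.contDiffAt (hP.mem_nhds hx))
    · refine (contDiffAt_const (c := (0 : E))).congr_of_eventuallyEq ?_
      filter_upwards [hD.isClosed.isOpen_compl.mem_nhds fun h => hx (hDP h)] with y hy
      simp [h0 y hy]
  · exact HasCompactSupport.intro hD fun x hx => by simp [h0 x hx]

/-- A `C¹` field with compact support is complete: it is bounded and globally Lipschitz, so the
Picard-Lindelöf theorem applies on every bounded time interval. -/
theorem exists_global_solution_of_hasCompactSupport {G : E → E} (hG : ContDiff ℝ 1 G)
    (hG' : HasCompactSupport G) (z₀ : E) :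
    ∃ z : ℝ → E, z 0 = z₀ ∧ ∀ t, HasDerivAt z (G (z t)) t := by
  obtain ⟨K, hK⟩ := ContDiff.lipschitzWith_of_hasCompactSupport (𝕂 := ℝ) hG' hG one_ne_zero
  obtain ⟨L, hL⟩ := hG'.exists_bound_of_continuous hG.continuous
  lift L to NNReal using (norm_nonneg _).trans (hL 0)
  have key : ∀ n : ℕ, ∃ α : ℝ → E, α 0 = z₀ ∧ ∀ t ∈ Ioo (-((n : ℝ) + 1)) (n + 1),
      HasDerivAt α (G (α t)) t := by
    intro n
    have hn : (0 : ℝ) < n + 1 := by positivity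
    have h0 : (0 : ℝ) ∈ Icc (-((n : ℝ) + 1)) (n + 1) := ⟨by linarith, hn.le⟩
    have hPL : IsPicardLindelof (fun _ => G) (⟨0, h0⟩ : Icc (-((n : ℝ) + 1)) (n + 1)) z₀
        (L * (n + 1)) 0 L K :=
      { lipschitzOnWith := fun _ _ => hK.lipschitzOnWith
        continuousOn := fun _ _ => continuousOn_const
        norm_le := fun _ _ x _ => hL x
        mul_max_le := by simp }
    obtain ⟨α, hα0, hα⟩ := hPL.exists_eq_forall_mem_Icc_hasDerivWithinAt₀
    exact ⟨α, hα0, fun t ht => (hα t (Ioo_subset_Icc_self ht)).hasDerivAt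
      (Icc_mem_nhds ht.1 ht.2)⟩
  choose α hα0 hα using key
  -- the solutions on growing intervals agree where both are defined
  have agree : ∀ n k : ℕ, n ≤ k → ∀ t ∈ Ioo (-((n : ℝ) + 1)) (n + 1), α n t = α k t := by
    intro n k hnk t ht
    have hnk' : (n : ℝ) ≤ k := by exact_mod_cast hnk
    have hn : (0 : ℝ) ≤ n := by positivity
    refine ODE_solution_unique_of_mem_Ioo (v := fun _ => G) (s := fun _ => univ) (K := K)
      (t₀ := 0) (fun _ _ => hK.lipschitzOnWith) ⟨by linarith, by linarith⟩
      (fun s hs => ⟨hα n s hs, trivial⟩)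
      (fun s hs => ⟨hα k s ⟨by linarith [hs.1], by linarith [hs.2]⟩, trivial⟩)
      (by rw [hα0, hα0]) ht
  refine ⟨fun t => α ⌈|t|⌉₊ t, by simp [hα0], fun t => ?_⟩
  set N := ⌈|t|⌉₊ with hN
  have hNt : |t| ≤ N := Nat.le_ceil _
  have ht : t ∈ Ioo (-((N : ℝ) + 1)) (N + 1) := by
    rcases abs_le.1 hNt with ⟨h1, h2⟩
    constructor <;> linarith
  refine (hα N t ht).congr_of_eventuallyEq ?_
  filter_upwards [Ioo_mem_nhds ht.1 ht.2] with s hs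
  have hs' : s ∈ Ioo (-((⌈|s|⌉₊ : ℝ) + 1)) (⌈|s|⌉₊ + 1) := by
    rcases abs_le.1 (Nat.le_ceil |s|) with ⟨h1, h2⟩
    constructor <;> linarith
  rcases le_total ⌈|s|⌉₊ N with h | h
  · exact agree _ _ h s hs'
  · exact (agree _ _ h s hs).symm

/-- Uniqueness of solutions of a `C¹` field on an open set. -/
theorem IsSolutionOn.eqOn_Icc {F : E → E} {P : Set E} (hP : IsOpen P)
    (hF : ContDiffOn ℝ 1 F P) {T : ℝ} {z w : ℝ → E} (hz : IsSolutionOn F P z (Icc 0 T))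
    (hw : IsSolutionOn F P w (Icc 0 T)) (h0 : z 0 = w 0) : EqOn z w (Icc 0 T) := by
  have hzc : ContinuousOn z (Icc 0 T) := fun t ht => (hz t ht).2.continuousWithinAt
  have hwc : ContinuousOn w (Icc 0 T) := fun t ht => (hw t ht).2.continuousWithinAt
  obtain ⟨χ, -, hχ, -, hG, hG'⟩ := exists_cutoff_field hP hF
    ((isCompact_Icc.image_of_continuousOn hzc).union (isCompact_Icc.image_of_continuousOn hwc))
    (by
      rintro x (⟨t, ht, rfl⟩ | ⟨t, ht, rfl⟩)
      exacts [(hz t ht).1, (hw t ht).1])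
  obtain ⟨K, hK⟩ := ContDiff.lipschitzWith_of_hasCompactSupport (𝕂 := ℝ) hG' hG one_ne_zero
  have aux : ∀ u : ℝ → E, IsSolutionOn F P u (Icc 0 T) → (∀ t ∈ Icc 0 T, χ (u t) = 1) →
      ∀ t ∈ Ico 0 T, HasDerivWithinAt u (χ (u t) • F (u t)) (Ici t) t := by
    intro u hu hχu t ht
    have := (hu t (Ico_subset_Icc_self ht)).2
    rw [hχu t (Ico_subset_Icc_self ht), one_smul]
    refine this.mono_of_mem_nhdsWithin ?_
    exact mem_of_superset (Icc_mem_nhdsGE ht.2) (Icc_subset_Icc_left ht.1)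
  exact ODE_solution_unique (v := fun _ x => χ x • F x) (fun _ => hK) hzc
    (aux z hz fun t ht => hχ _ (Or.inl ⟨t, ht, rfl⟩)) hwc
    (aux w hw fun t ht => hχ _ (Or.inr ⟨t, ht, rfl⟩)) h0

/-- Global existence forward in time from a Lyapunov function `V` whose sublevel set through the
initial point is compact. -/
theorem exists_forward_solution_of_lyapunov {F : E → E} {P : Set E} (hP : IsOpen P)
    (hF : ContDiffOn ℝ 1 F P) {V : E → ℝ} {V' : E → E →L[ℝ] ℝ}
    (hV : ∀ z ∈ P, HasFDerivAt V (V' z) z) (hV' : ∀ z ∈ P, V' z (F z) ≤ 0)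
    {z₀ : E} (hz₀ : z₀ ∈ P) (hC : IsCompact {z | z ∈ P ∧ V z ≤ V z₀}) :
    ∃ z : ℝ → E, z 0 = z₀ ∧ IsSolutionOn F P z (Ici 0) := by
  obtain ⟨χ, hχ0, hχ1, hχP, hG, hG'⟩ := exists_cutoff_field hP hF hC fun z hz => hz.1
  obtain ⟨z, hz0, hz⟩ := exists_global_solution_of_hasCompactSupport hG hG' z₀
  obtain ⟨K, hK⟩ := ContDiff.lipschitzWith_of_hasCompactSupport (𝕂 := ℝ) hG' hG one_ne_zero
  -- points outside `P` are equilibria of the field cut off by `χ`, hence are never reached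
  have hzP : ∀ t, z t ∈ P := by
    intro t
    by_contra h
    have : z = fun _ => z t := ODE_solution_unique_univ (v := fun _ x => χ x • F x)
      (s := fun _ => univ) (K := K) (t₀ := t) (fun _ => hK.lipschitzOnWith)
      (fun s => ⟨hz s, trivial⟩)
      (fun s => ⟨by simpa [hχP _ h] using hasDerivAt_const s (z t), trivial⟩) rfl
    exact h (by rw [← congrFun this 0, hz0]; exact hz₀)
  have hd : ∀ t, HasDerivAt (fun t => V (z t)) (V' (z t) (χ (z t) • F (z t))) t := fun t =>
    (hV _ (hzP t)).comp_hasDerivAt t (hz t)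
  have hanti : Antitone fun t => V (z t) :=
    antitone_of_hasDerivAt_nonpos hd fun t => by
      simpa using mul_nonpos_of_nonneg_of_nonpos (hχ0 (z t)) (hV' _ (hzP t))
  refine ⟨z, hz0, fun t ht => ⟨hzP t, ?_⟩⟩
  have h1 : χ (z t) = 1 := hχ1 _ ⟨hzP t, by simpa [hz0] using hanti ht⟩
  simpa [h1] using (hz t).hasDerivWithinAt (s := Ici 0)

end ODE

/-! ### Lyapunov functions with compact sublevel sets -/

section Lyapunov

variable {E : Type*} [NormedAddCommGroup E] [NormedSpace ℝ E]

theorem IsSolutionOn.hasDerivAt {F : E → E} {P : Set E} {z : ℝ → E}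
    (hz : IsSolutionOn F P z (Ici 0)) {t : ℝ} (ht : 0 < t) : HasDerivAt z (F (z t)) t :=
  (hz t ht.le).2.hasDerivAt (Ici_mem_nhds ht)

theorem IsSolutionOn.continuousOn {F : E → E} {P s} {z : ℝ → E} (hz : IsSolutionOn F P z s) :
    ContinuousOn z s := fun t ht => (hz t ht).2.continuousWithinAt

/-- If the derivative of `W` along a solution is at most `-ε`, then `W` decreases at least
linearly along it. -/
theorem IsSolutionOn.antitoneOn_add_mul {F : E → E} {P : Set E} {z : ℝ → E}
    (hz : IsSolutionOn F P z (Ici 0)) {W : E → ℝ} {W' : E → E →L[ℝ] ℝ}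
    (hW : ∀ x ∈ P, HasFDerivAt W (W' x) x) {ε : ℝ}
    (hε : ∀ t, 0 ≤ t → W' (z t) (F (z t)) ≤ -ε) :
    AntitoneOn (fun t => W (z t) + ε * t) (Ici 0) := by
  have hd : ∀ t, 0 < t → HasDerivAt (fun t => W (z t) + ε * t)
      (W' (z t) (F (z t)) + ε) t := fun t ht => by
    have h := ((hW _ (hz t ht.le).1).comp_hasDerivAt t (hz.hasDerivAt ht)).add
      ((hasDerivAt_id t).const_mul ε)
    rwa [mul_one] at h
  refine antitoneOn_of_deriv_nonpos (convex_Ici 0) ?_ ?_ ?_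
  · refine ContinuousOn.add (fun t ht => ?_) (by fun_prop)
    exact (hW _ (hz t ht).1).continuousAt.comp_continuousWithinAt (hz.continuousOn t ht)
  · intro t ht
    rw [interior_Ici] at ht
    exact (hd t ht).differentiableAt.differentiableWithinAt
  · intro t ht
    rw [interior_Ici] at ht
    rw [(hd t ht).deriv]
    linarith [hε t (le_of_lt ht)]

/-- The sets `{V < V zs + δ}` form a neighbourhood basis of a strict global minimizer `zs` of a
function with compact sublevel sets. -/
theorem exists_sublevel_subset_of_strictMin {X : Type*} [TopologicalSpace X] {P : Set X}
    {V : X → ℝ} (hVc : ContinuousOn V P) (hcomp : ∀ c, IsCompact {z | z ∈ P ∧ V z ≤ c}) {zs : X}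
    (hmin : ∀ z ∈ P, z ≠ zs → V zs < V z) {U : Set X} (hU : U ∈ 𝓝 zs) :
    ∃ δ > 0, ∀ z ∈ P, V z < V zs + δ → z ∈ U := by
  have hC : IsCompact ({z | z ∈ P ∧ V z ≤ V zs + 1} \ interior U) := (hcomp _).diff isOpen_interior
  rcases Set.eq_empty_or_nonempty ({z | z ∈ P ∧ V z ≤ V zs + 1} \ interior U) with h | h
  · refine ⟨1, one_pos, fun z hz hVz => interior_subset ?_⟩
    by_contra hzU
    exact h.subset ⟨⟨hz, hVz.le⟩, hzU⟩
  · obtain ⟨y, hy, hymin⟩ := hC.exists_isMinOn h (hVc.mono fun z hz => hz.1.1)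
    have hys : y ≠ zs := fun h => hy.2 (h ▸ mem_interior_iff_mem_nhds.2 hU)
    have := hmin y hy.1.1 hys
    refine ⟨min 1 (V y - V zs), by simp [this], fun z hz hVz => interior_subset ?_⟩
    by_contra hzU
    have h1 : V z < V zs + 1 := hVz.trans_le (by gcongr; exact min_le_left _ _)
    have h2 : V z < V y := by linarith [min_le_right 1 (V y - V zs)]
    exact absurd (hymin ⟨⟨hz, h1.le⟩, hzU⟩) (not_le.2 h2)

/-- Global asymptotic stability from a weak Lyapunov function `V`, with compact sublevel sets and
a strict minimum at `zs`, together with, on each sublevel set, a function `W` whose derivative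
along the field is negative away from `zs`. The functions `W` need not have a minimum at `zs`:
they only prevent `V` from levelling off above `V zs`. -/
theorem exists_flow_of_lyapunov [FiniteDimensional ℝ E] {F : E → E} {P : Set E} (hP : IsOpen P)
    (hF : ContDiffOn ℝ 1 F P) {V : E → ℝ} {V' : E → E →L[ℝ] ℝ}
    (hV : ∀ z ∈ P, HasFDerivAt V (V' z) z) (hV' : ∀ z ∈ P, V' z (F z) ≤ 0)
    (hcomp : ∀ c, IsCompact {z | z ∈ P ∧ V z ≤ c}) {zs : E} (hzs : zs ∈ P)
    (hmin : ∀ z ∈ P, z ≠ zs → V zs < V z)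
    (hstrict : ∀ c, ∃ (W : E → ℝ) (W' : E → E →L[ℝ] ℝ) (ρ : E → ℝ),
      (∀ z ∈ P, HasFDerivAt W (W' z) z) ∧ ContinuousOn ρ P ∧
      (∀ z ∈ P, V z ≤ c → W' z (F z) ≤ -ρ z) ∧ (∀ z ∈ P, z ≠ zs → 0 < ρ z)) :
    ∃ φ : ℝ → E → E, IsForwardFlow F P φ ∧ IsLyapunovAsymptoticallyStable P φ zs ∧
      P ⊆ regionOfAttraction P φ zs := by
  have hVc : ContinuousOn V P := fun z hz => (hV z hz).continuousAt.continuousWithinAt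
  have hex : ∀ z₀, ∃ z : ℝ → E, z 0 = z₀ ∧ (z₀ ∈ P → IsSolutionOn F P z (Ici 0)) := by
    intro z₀
    by_cases h : z₀ ∈ P
    · obtain ⟨z, hz0, hz⟩ := exists_forward_solution_of_lyapunov hP hF hV hV' h (hcomp _)
      exact ⟨z, hz0, fun _ => hz⟩
    · exact ⟨fun _ => z₀, rfl, fun h' => absurd h' h⟩
  choose Φ hΦ0 hΦ using hex
  have hanti : ∀ z₀ ∈ P, AntitoneOn (fun t => V (Φ z₀ t)) (Ici 0) := fun z₀ hz₀ => by
    simpa using (hΦ z₀ hz₀).antitoneOn_add_mul hV (ε := 0)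
      (fun t ht => by simpa using hV' _ ((hΦ z₀ hz₀) t ht).1)
  have hle : ∀ z₀ ∈ P, ∀ t, 0 ≤ t → V (Φ z₀ t) ≤ V z₀ := fun z₀ hz₀ t ht => by
    simpa [hΦ0] using hanti z₀ hz₀ self_mem_Ici ht ht
  have hlim : ∀ z₀ ∈ P, Tendsto (Φ z₀) atTop (𝓝 zs) := by
    intro z₀ hz₀
    -- otherwise the solution stays in a compact set on which `W` decreases at a uniform rate
    have hreach : ∀ δ > 0, ∃ t, 0 ≤ t ∧ V (Φ z₀ t) < V zs + δ := by
      intro δ hδ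
      by_contra! hcon
      obtain ⟨W, W', ρ, hW, hρ, hWρ, hpos⟩ := hstrict (V z₀)
      have hCP : {z | z ∈ P ∧ V z ≤ V z₀} ⊆ P := fun z hz => hz.1
      have hC : IsCompact ({z | z ∈ P ∧ V z ≤ V z₀} ∩ V ⁻¹' Ici (V zs + δ)) := by
        refine (hcomp _).of_isClosed_subset ?_ inter_subset_left
        exact (hVc.mono hCP).preimage_isClosed_of_isClosed (hcomp _).isClosed isClosed_Ici
      have hmem : ∀ t, 0 ≤ t →
          Φ z₀ t ∈ {z | z ∈ P ∧ V z ≤ V z₀} ∩ V ⁻¹' Ici (V zs + δ) := fun t ht =>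
        ⟨⟨(hΦ z₀ hz₀ t ht).1, hle z₀ hz₀ t ht⟩, hcon t ht⟩
      obtain ⟨y, hy, hymin⟩ := hC.exists_isMinOn ⟨_, hmem 0 le_rfl⟩
        (hρ.mono fun z hz => hz.1.1)
      obtain ⟨b, -, hbmin⟩ := hC.exists_isMinOn ⟨_, hmem 0 le_rfl⟩
        (f := W) (fun z hz => (hW z hz.1.1).continuousAt.continuousWithinAt)
      have hyρ : 0 < ρ y := hpos y hy.1.1 fun h => by
        have : V zs + δ ≤ V y := hy.2
        rw [h] at this
        linarith
      have hdec := (hΦ z₀ hz₀).antitoneOn_add_mul hW (ε := ρ y) fun t ht =>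
        (hWρ _ (hmem t ht).1.1 (hmem t ht).1.2).trans (neg_le_neg (hymin (hmem t ht)))
      obtain ⟨t, ht⟩ := exists_gt ((W (Φ z₀ 0) - W b) / ρ y)
      have ht0 : 0 ≤ t := (div_nonneg (sub_nonneg.2 (hbmin (hmem 0 le_rfl))) hyρ.le).trans ht.le
      have h1 := hdec self_mem_Ici ht0 ht0
      have h2 : W b ≤ W (Φ z₀ t) := hbmin (hmem t ht0)
      rw [div_lt_iff₀ hyρ] at ht
      simp only [mul_zero, add_zero] at h1
      linarith
    intro U hU
    obtain ⟨δ, hδ, hδU⟩ := exists_sublevel_subset_of_strictMin hVc hcomp hmin hU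
    obtain ⟨t₀, ht₀, ht₀'⟩ := hreach δ hδ
    rw [mem_map]
    filter_upwards [eventually_ge_atTop t₀] with t ht
    exact hδU _ (hΦ z₀ hz₀ t (ht₀.trans ht)).1
      ((hanti z₀ hz₀ ht₀ (mem_Ici.2 (ht₀.trans ht)) ht).trans_lt ht₀')
  refine ⟨fun t z₀ => Φ z₀ t, ?_, ⟨hP.mem_nhds hzs, ?_, ?_, ?_⟩, fun z₀ hz₀ => ⟨hz₀, hlim z₀ hz₀⟩⟩
  · refine fun z₀ hz₀ => ⟨hΦ0 z₀, hΦ z₀ hz₀, fun T w hT hw0 hw t ht => ?_⟩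
    refine hw.eqOn_Icc hP hF (fun s hs => ?_) (by rw [hw0, hΦ0]) ht
    exact ⟨(hΦ z₀ hz₀ s hs.1).1, (hΦ z₀ hz₀ s hs.1).2.mono Icc_subset_Ici_self⟩
  · intro t ht
    by_contra h
    exact absurd (hmin _ (hΦ zs hzs t ht).1 h) (not_lt.2 (hle zs hzs t ht))
  · intro U hU
    obtain ⟨δ, hδ, hδU⟩ := exists_sublevel_subset_of_strictMin hVc hcomp hmin hU
    refine ⟨P ∩ {z | V z < V zs + δ}, inter_mem (hP.mem_nhds hzs)
      ((hV zs hzs).continuousAt.eventually_lt continuousAt_const (by linarith)), ?_⟩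
    rintro z₀ ⟨hz₀, hVz₀⟩ t ht
    exact hδU _ (hΦ z₀ hz₀ t ht).1 ((hle z₀ hz₀ t ht).trans_lt hVz₀)
  · filter_upwards [hP.mem_nhds hzs] with z₀ hz₀ using hlim z₀ hz₀

end Lyapunov

/-! ### The heavy-ball flow of a coercive function -/

section HeavyBall

variable {E : Type*} [NormedAddCommGroup E] [InnerProductSpace ℝ E] [FiniteDimensional ℝ E]

/-- The heavy-ball flow of a function `f` on an open set `S`, with compact sublevel sets and with a
strict global minimizer as its only stationary point, is globally asymptotically stable.
The energy `f K + ‖p‖² / 2` is a weak Lyapunov function; adding a small multiple of `⟪∇f K, p⟫`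
makes its derivative along the flow negative away from the equilibrium. -/
theorem exists_heavyBall_flow [CompleteSpace E] {f : E → ℝ} {g : E → E} {S : Set E} (hS : IsOpen S)
    (hf : ∀ K ∈ S, HasGradientAt f (g K) K) (hg : ContDiffOn ℝ 1 g S)
    (hcomp : ∀ c, IsCompact {K | K ∈ S ∧ f K ≤ c}) {Ks : E} (hKs : Ks ∈ S)
    (hstat : ∀ K ∈ S, g K = 0 → K = Ks) (hmin : ∀ K ∈ S, K ≠ Ks → f Ks < f K)
    {d : ℝ} (hd : 0 < d) :
    ∃ φ : ℝ → E × E → E × E,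
      IsForwardFlow (fun z : E × E => (z.2, -g z.1 - (2 * d) • z.2)) (S ×ˢ univ) φ ∧
      IsLyapunovAsymptoticallyStable (S ×ˢ univ) φ (Ks, 0) ∧
      S ×ˢ univ ⊆ regionOfAttraction (S ×ˢ univ) φ (Ks, 0) := by
  set P : Set (E × E) := S ×ˢ univ with hPdef
  have hP : IsOpen P := hS.prod isOpen_univ
  have hle : ∀ K ∈ S, f Ks ≤ f K := fun K hK => by
    rcases eq_or_ne K Ks with rfl | h
    exacts [le_rfl, (hmin K hK h).le]
  have hg1 : ContDiffOn ℝ 1 (fun z : E × E => g z.1) P :=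
    hg.comp contDiff_fst.contDiffOn fun z hz => hz.1
  let V : E × E → ℝ := fun z => f z.1 + ‖z.2‖ ^ 2 / 2
  have hV1 : ∀ z ∈ P, HasFDerivAt V ((innerSL ℝ (g z.1)).comp (.fst ℝ E E) +
      (innerSL ℝ z.2).comp (.snd ℝ E E)) z := by
    intro z hz
    have h1 : HasFDerivAt (fun z : E × E => f z.1) ((innerSL ℝ (g z.1)).comp (.fst ℝ E E)) z :=
      (hf z.1 hz.1).hasFDerivAt.comp z hasFDerivAt_fst
    have h2 : HasFDerivAt (fun z : E × E => ‖z.2‖ ^ 2 / 2)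
        ((innerSL ℝ z.2).comp (.snd ℝ E E)) z := by
      have := ((hasFDerivAt_snd (𝕜 := ℝ) (E := E) (F := E) (p := z)).norm_sq).mul_const (1 / 2 : ℝ)
      refine (this.congr_fderiv ?_).congr_of_eventuallyEq (Eventually.of_forall fun y => by
        simp [div_eq_mul_inv])
      ext v <;> simp
    exact h1.add h2
  have hg' : ∀ z ∈ P, HasFDerivAt (fun z : E × E => inner ℝ (g z.1) z.2)
      ((innerSL ℝ (g z.1)).comp (.snd ℝ E E) +
        (innerSL ℝ z.2).comp ((fderiv ℝ g z.1).comp (.fst ℝ E E))) z := by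
    intro z hz
    have h1 : HasFDerivAt (fun z : E × E => g z.1) ((fderiv ℝ g z.1).comp (.fst ℝ E E)) z :=
      ((hg.contDiffAt (hS.mem_nhds hz.1)).differentiableAt one_ne_zero).hasFDerivAt.comp z
        hasFDerivAt_fst
    refine (h1.inner ℝ hasFDerivAt_snd).congr_fderiv ?_
    ext v <;> simp [real_inner_comm]
  have hVcomp : ∀ c, IsCompact {z | z ∈ P ∧ V z ≤ c} := by
    intro c
    have hD := (hcomp c).prod (isCompact_closedBall (0 : E) (Real.sqrt (2 * (c - f Ks))))
    have hDP : {K | K ∈ S ∧ f K ≤ c} ×ˢ Metric.closedBall (0 : E) (Real.sqrt (2 * (c - f Ks))) ⊆ P :=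
      fun z hz => ⟨hz.1.1, trivial⟩
    have hcl := ContinuousOn.preimage_isClosed_of_isClosed
      (fun z hz => (hV1 z (hDP hz)).continuousAt.continuousWithinAt) hD.isClosed
      (isClosed_Iic (a := c))
    convert hD.of_isClosed_subset hcl inter_subset_left using 1
    ext z
    constructor
    · rintro ⟨hz, hVz⟩
      have h1 := hle z.1 hz.1
      have h2 : f z.1 + ‖z.2‖ ^ 2 / 2 ≤ c := hVz
      refine ⟨⟨⟨hz.1, by nlinarith [sq_nonneg ‖z.2‖]⟩, ?_⟩, hVz⟩
      exact mem_closedBall_zero_iff.2 (Real.le_sqrt_of_sq_le (by linarith))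
    · exact fun hz => ⟨hDP hz.1, hz.2⟩
  refine exists_flow_of_lyapunov hP ?_ hV1 ?_ hVcomp ⟨hKs, trivial⟩ ?_ ?_
  · exact contDiff_snd.contDiffOn.prodMk (hg1.neg.sub (contDiff_snd.const_smul _).contDiffOn)
  · intro z hz
    simp only [add_apply, ContinuousLinearMap.comp_apply,
      ContinuousLinearMap.coe_fst', ContinuousLinearMap.coe_snd', innerSL_apply_apply,
      inner_sub_right, inner_neg_right, inner_smul_right, real_inner_self_eq_norm_sq,
      real_inner_comm z.2]
    nlinarith [sq_nonneg ‖z.2‖]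
  · rintro ⟨K, p⟩ hz hne
    rcases eq_or_ne K Ks with rfl | h
    · have hp : p ≠ 0 := fun h => hne (by rw [h])
      have : 0 < ‖p‖ := norm_pos_iff.2 hp
      simp only [V, norm_zero]
      nlinarith
    · have := hmin K hz.1 h
      simp only [V, norm_zero]
      nlinarith [sq_nonneg ‖p‖]
  · intro c
    have hgc : ContinuousOn (fderiv ℝ g) S := hg.continuousOn_fderiv_of_isOpen hS le_rfl
    obtain ⟨h, hh⟩ := (hcomp c).exists_bound_of_continuousOn (hgc.mono fun K hK => hK.1)
    have hh0 : 0 ≤ max h 0 := le_max_right _ _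
    have hden : 0 < max h 0 + 2 * d ^ 2 := by positivity
    -- this choice of `ε` leaves the coefficient `d` in front of `‖p‖²`
    set ε := d / (max h 0 + 2 * d ^ 2) with hε
    have hε0 : 0 < ε := by positivity
    have hεd : ε * (max h 0 + 2 * d ^ 2) = d := div_mul_cancel₀ _ hden.ne'
    refine ⟨fun z => V z + ε * inner ℝ (g z.1) z.2, _,
      fun z => d * ‖z.2‖ ^ 2 + ε / 2 * ‖g z.1‖ ^ 2,
      fun z hz => (hV1 z hz).add ((hg' z hz).const_mul ε), ?_, ?_, ?_⟩
    · exact (by fun_prop : Continuous fun z : E × E => d * ‖z.2‖ ^ 2).continuousOn.add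
        (continuousOn_const.mul (hg1.continuousOn.norm.pow 2))
    · intro z hz hVz
      have hfz : f z.1 ≤ c := by
        have h2 : f z.1 + ‖z.2‖ ^ 2 / 2 ≤ c := hVz
        nlinarith [sq_nonneg ‖z.2‖]
      have hD : inner ℝ z.2 (fderiv ℝ g z.1 z.2) ≤ max h 0 * ‖z.2‖ ^ 2 :=
        calc inner ℝ z.2 (fderiv ℝ g z.1 z.2) ≤ ‖z.2‖ * ‖fderiv ℝ g z.1 z.2‖ :=
              real_inner_le_norm _ _
          _ ≤ ‖z.2‖ * (max h 0 * ‖z.2‖) := by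
              gcongr
              exact (fderiv ℝ g z.1).le_of_opNorm_le ((hh _ ⟨hz.1, hfz⟩).trans (le_max_left _ _)) _
          _ = max h 0 * ‖z.2‖ ^ 2 := by ring
      have hsq : 0 ≤ ‖g z.1‖ ^ 2 + 2 * ((2 * d) * inner ℝ (g z.1) z.2) + (2 * d) ^ 2 * ‖z.2‖ ^ 2 := by
        have := norm_add_sq_real (g z.1) ((2 * d) • z.2)
        rw [inner_smul_right, norm_smul, mul_pow, Real.norm_eq_abs, sq_abs] at this
        rw [← this]
        positivity
      have hD' := mul_le_mul_of_nonneg_left hD hε0.le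
      have hsq' := mul_nonneg hε0.le hsq
      have hεd' : ε * (max h 0 + 2 * d ^ 2) * ‖z.2‖ ^ 2 = d * ‖z.2‖ ^ 2 := by rw [hεd]
      simp only [add_apply, ContinuousLinearMap.comp_apply,
        smul_apply, smul_eq_mul,
        ContinuousLinearMap.coe_fst', ContinuousLinearMap.coe_snd', innerSL_apply_apply,
        inner_sub_right, inner_neg_right, inner_smul_right, real_inner_self_eq_norm_sq,
        real_inner_comm z.2]
      simp only [real_inner_comm z.2] at hsq'
      nlinarith
    · rintro ⟨K, p⟩ hz hne
      rcases eq_or_ne p 0 with rfl | hp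
      · have hgK : g K ≠ 0 := fun h0 => hne (by rw [hstat K hz.1 h0])
        have : 0 < ‖g K‖ := norm_pos_iff.2 hgK
        positivity
      · have : 0 < ‖p‖ := norm_pos_iff.2 hp
        positivity

end HeavyBall

/-! ### Decay of the matrix exponential of a Hurwitz matrix -/

/-- By Gelfand's formula, the powers of an element of a complex Banach algebra tend to zero if its
spectrum lies in the open unit disc. -/
theorem tendsto_pow_atTop_nhds_zero_of_spectrum {A : Type*} [NormedRing A] [NormedAlgebra ℂ A]
    [CompleteSpace A] {a : A} (ha : ∀ z ∈ spectrum ℂ a, ‖z‖ < 1) :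
    Tendsto (fun k : ℕ => a ^ k) atTop (𝓝 0) := by
  rcases subsingleton_or_nontrivial A with h | h
  · exact tendsto_const_nhds.congr fun k => Subsingleton.elim _ _
  have hρ : spectralRadius ℂ a < (1 : NNReal) :=
    spectrum.spectralRadius_lt_of_forall_lt a fun z hz => by
      rw [← NNReal.coe_lt_coe]
      simpa using ha z hz
  obtain ⟨r, hr, hr1⟩ := ENNReal.lt_iff_exists_nnreal_btwn.1 hρ
  rw [ENNReal.coe_lt_coe] at hr1
  have hev := (spectrum.pow_nnnorm_pow_one_div_tendsto_nhds_spectralRadius a).eventually_lt_const hr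
  refine squeeze_zero_norm' ?_ (tendsto_pow_atTop_nhds_zero_of_lt_one r.2 hr1)
  filter_upwards [hev, eventually_gt_atTop 0] with k hk hk0
  have hk0' : (0 : ℝ) < k := by exact_mod_cast hk0
  have h1 := ENNReal.rpow_le_rpow hk.le hk0'.le
  rw [← ENNReal.rpow_mul, one_div, inv_mul_cancel₀ hk0'.ne', ENNReal.rpow_one,
    ENNReal.rpow_natCast] at h1
  exact_mod_cast h1

section Exp

attribute [local instance] Matrix.frobeniusNormedRing Matrix.frobeniusNormedAlgebra

variable {n : ℕ}

theorem Matrix.mem_spectrum_iff_exists_mulVec {N : Matrix (Fin n) (Fin n) ℂ} {s : ℂ} :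
    s ∈ spectrum ℂ N ↔ ∃ v ≠ 0, N *ᵥ v = s • v := by
  rw [← Matrix.spectrum_toLin', ← Module.End.hasEigenvalue_iff_mem_spectrum]
  constructor
  · intro h
    obtain ⟨v, hv⟩ := h.exists_hasEigenvector
    exact ⟨v, hv.2, by simpa using hv.apply_eq_smul⟩
  · rintro ⟨v, hv, h⟩
    exact Module.End.hasEigenvalue_of_hasEigenvector (x := v)
      ⟨Module.End.mem_eigenspace_iff.2 (by simpa using h), hv⟩

theorem Matrix.exp_mulVec_of_mulVec_eq_smul {N : Matrix (Fin n) (Fin n) ℂ} {s : ℂ} {v : Fin n → ℂ}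
    (h : N *ᵥ v = s • v) : NormedSpace.exp N *ᵥ v = Complex.exp s • v := by
  have hpow : ∀ k : ℕ, (N ^ k) *ᵥ v = s ^ k • v := by
    intro k
    induction k with
    | zero => simp
    | succ k ih =>
      rw [pow_succ, ← Matrix.mulVec_mulVec, h, Matrix.mulVec_smul, ih, smul_smul, pow_succ']
  have h1 := NormedSpace.exp_series_hasSum_exp' (𝕂 := ℂ) N
  have h2 : HasSum (fun k : ℕ => ((k.factorial : ℂ)⁻¹ • N ^ k) *ᵥ v) (NormedSpace.exp N *ᵥ v) :=
    h1.map (AddMonoidHom.mk' (fun X : Matrix (Fin n) (Fin n) ℂ => X *ᵥ v)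
      fun X Y => Matrix.add_mulVec X Y v) (Continuous.matrix_mulVec continuous_id continuous_const)
  have h3 := (NormedSpace.exp_series_hasSum_exp' (𝕂 := ℂ) s).smul_const v
  rw [← Complex.exp_eq_exp_ℂ] at h3
  refine h2.unique ?_
  convert h3 using 2 with k
  rw [Matrix.smul_mulVec, hpow, smul_assoc]

/-- The nontrivial half of the spectral mapping theorem for the exponential: each eigenspace of
`exp N` is invariant under `N`, hence contains an eigenvector of `N`. -/
theorem Matrix.exists_mem_spectrum_of_mem_spectrum_exp {N : Matrix (Fin n) (Fin n) ℂ} {z : ℂ}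
    (hz : z ∈ spectrum ℂ (NormedSpace.exp N)) : ∃ s ∈ spectrum ℂ N, Complex.exp s = z := by
  obtain ⟨v, hv0, hv⟩ := Matrix.mem_spectrum_iff_exists_mulVec.1 hz
  set T := Matrix.toLin' (NormedSpace.exp N) with hT
  have hmaps : ∀ w ∈ Module.End.eigenspace T z, Matrix.toLin' N w ∈ Module.End.eigenspace T z := by
    intro w hw
    rw [Module.End.mem_eigenspace_iff, hT, Matrix.toLin'_apply] at hw
    rw [Module.End.mem_eigenspace_iff, hT, Matrix.toLin'_apply, Matrix.toLin'_apply,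
      Matrix.mulVec_mulVec, ((Commute.refl N).exp_left).eq, ← Matrix.mulVec_mulVec, hw,
      Matrix.mulVec_smul]
  have hvT : v ∈ Module.End.eigenspace T z := Module.End.mem_eigenspace_iff.2 (by simpa [hT] using hv)
  have : Nontrivial (Module.End.eigenspace T z) := ⟨⟨v, hvT⟩, 0, fun h => hv0 (congrArg Subtype.val h)⟩
  obtain ⟨s, hs⟩ := Module.End.exists_eigenvalue ((Matrix.toLin' N).restrict hmaps)
  obtain ⟨w, hw⟩ := hs.exists_hasEigenvector
  have hw0 : (w : Fin n → ℂ) ≠ 0 := fun h => hw.2 (Subtype.ext h)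
  have hNw : N *ᵥ (w : Fin n → ℂ) = s • (w : Fin n → ℂ) := by
    have := congrArg Subtype.val hw.apply_eq_smul
    simpa using this
  refine ⟨s, Matrix.mem_spectrum_iff_exists_mulVec.2 ⟨w, hw0, hNw⟩, ?_⟩
  have h1 := Matrix.exp_mulVec_of_mulVec_eq_smul hNw
  have h2 : NormedSpace.exp N *ᵥ (w : Fin n → ℂ) = z • (w : Fin n → ℂ) := by
    simpa [hT] using Module.End.mem_eigenspace_iff.1 w.2
  exact smul_left_injective ℂ hw0 (h1.symm.trans h2)

/-- The exponential of a Hurwitz matrix decays. -/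
theorem Matrix.tendsto_exp_smul_of_spectrum {M : Matrix (Fin n) (Fin n) ℝ}
    (hM : ∀ s ∈ spectrum ℂ (M.map (algebraMap ℝ ℂ)), s.re < 0) :
    Tendsto (fun t : ℝ => NormedSpace.exp (t • M)) atTop (𝓝 0) := by
  have hmap : (NormedSpace.exp M).map (algebraMap ℝ ℂ) =
      NormedSpace.exp (M.map (algebraMap ℝ ℂ)) :=
    NormedSpace.map_exp (algebraMap ℝ ℂ).mapMatrix
      (continuous_id.matrix_map (continuous_algebraMap ℝ ℂ)) M
  have hpow : Tendsto (fun k : ℕ => NormedSpace.exp M ^ k) atTop (𝓝 0) := by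
    have h1 : Tendsto (fun k : ℕ => NormedSpace.exp (M.map (algebraMap ℝ ℂ)) ^ k) atTop (𝓝 0) :=
      tendsto_pow_atTop_nhds_zero_of_spectrum fun z hz => by
        obtain ⟨s, hs, rfl⟩ := Matrix.exists_mem_spectrum_of_mem_spectrum_exp hz
        rw [Complex.norm_exp, Real.exp_lt_one_iff]
        exact hM s hs
    refine tendsto_zero_iff_norm_tendsto_zero.2
      ((tendsto_zero_iff_norm_tendsto_zero.1 h1).congr fun k => ?_)
    rw [← hmap, ← RingHom.mapMatrix_apply, ← map_pow, RingHom.mapMatrix_apply,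
      Matrix.frobenius_norm_map_eq _ _ fun a => by simp]
  have hfrac : ∃ C, ∀ t ∈ Icc (0 : ℝ) 1, ‖NormedSpace.exp (t • M)‖ ≤ C :=
    isCompact_Icc.exists_bound_of_continuousOn
      (NormedSpace.exp_continuous.comp (continuous_id.smul continuous_const)).continuousOn
  obtain ⟨C, hC⟩ := hfrac
  have hfloor : Tendsto (fun t : ℝ => ‖NormedSpace.exp M ^ ⌊t⌋₊‖ * C) atTop (𝓝 0) := by
    simpa using ((tendsto_zero_iff_norm_tendsto_zero.1 hpow).comp
      tendsto_nat_floor_atTop).mul_const C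
  refine squeeze_zero_norm' ?_ hfloor
  filter_upwards [eventually_ge_atTop 0] with t ht
  have hsplit : NormedSpace.exp (t • M) =
      NormedSpace.exp M ^ ⌊t⌋₊ * NormedSpace.exp ((t - ⌊t⌋₊) • M) := by
    rw [← Matrix.exp_nsmul, ← Matrix.exp_add_of_commute]
    · rw [← Nat.cast_smul_eq_nsmul ℝ, ← add_smul]
      congr 2
      ring
    · exact ((Commute.refl M).smul_left _).smul_right _
  rw [hsplit]
  refine (norm_mul_le _ _).trans ?_
  gcongr
  exact hC _ ⟨sub_nonneg.2 (Nat.floor_le ht), by linarith [Nat.lt_floor_add_one t]⟩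

theorem Matrix.hasDerivAt_exp_smul_mulVec (M : Matrix (Fin n) (Fin n) ℝ) (x : Fin n → ℝ) (t : ℝ) :
    HasDerivAt (fun t : ℝ => NormedSpace.exp (t • M) *ᵥ x)
      (M *ᵥ (NormedSpace.exp (t • M) *ᵥ x)) t := by
  let L : Matrix (Fin n) (Fin n) ℝ →L[ℝ] (Fin n → ℝ) :=
    LinearMap.toContinuousLinearMap ((Matrix.mulVecBilin ℝ ℝ).flip x)
  have h := L.hasFDerivAt.comp_hasDerivAt t (hasDerivAt_exp_smul_const' (𝕂 := ℝ) M t)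
  rw [Matrix.mulVec_mulVec]
  exact h

end Exp

/-! ### The Lyapunov equation -/

section LyapunovEquation

variable {n : ℕ} {M X W : Matrix (Fin n) (Fin n) ℝ}

theorem HasDerivAt.dotProduct_mulVec {u v : ℝ → Fin n → ℝ} {u' v' : Fin n → ℝ} {t : ℝ}
    (X : Matrix (Fin n) (Fin n) ℝ) (hu : HasDerivAt u u' t) (hv : HasDerivAt v v' t) :
    HasDerivAt (fun t => u t ⬝ᵥ (X *ᵥ v t)) (u' ⬝ᵥ (X *ᵥ v t) + u t ⬝ᵥ (X *ᵥ v')) t := by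
  have hu' := hasDerivAt_pi.1 hu
  have hv' := hasDerivAt_pi.1 hv
  simp only [Matrix.mulVec, dotProduct, ← Finset.sum_add_distrib]
  exact HasDerivAt.fun_sum fun i _ =>
    (hu' i).mul (HasDerivAt.fun_sum fun j _ => (hv' j).const_mul (X i j))

theorem Matrix.hasDerivAt_exp_smul_dotProduct (M X : Matrix (Fin n) (Fin n) ℝ) (x y : Fin n → ℝ)
    (t : ℝ) :
    HasDerivAt (fun t : ℝ => (NormedSpace.exp (t • M) *ᵥ x) ⬝ᵥ (X *ᵥ (NormedSpace.exp (t • M) *ᵥ y)))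
      ((NormedSpace.exp (t • M) *ᵥ x) ⬝ᵥ ((Mᵀ * X + X * M) *ᵥ (NormedSpace.exp (t • M) *ᵥ y))) t := by
  convert HasDerivAt.dotProduct_mulVec X (Matrix.hasDerivAt_exp_smul_mulVec M x t)
    (Matrix.hasDerivAt_exp_smul_mulVec M y t) using 1
  rw [Matrix.add_mulVec, dotProduct_add, ← Matrix.mulVec_mulVec, ← Matrix.mulVec_mulVec,
    Matrix.dotProduct_mulVec _ Mᵀ, Matrix.vecMul_transpose]

theorem Matrix.tendsto_exp_smul_dotProduct
    (hM : Tendsto (fun t : ℝ => NormedSpace.exp (t • M)) atTop (𝓝 0))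
    (X : Matrix (Fin n) (Fin n) ℝ) (x y : Fin n → ℝ) :
    Tendsto (fun t : ℝ => (NormedSpace.exp (t • M) *ᵥ x) ⬝ᵥ (X *ᵥ (NormedSpace.exp (t • M) *ᵥ y)))
      atTop (𝓝 0) := by
  have hc : Continuous fun N : Matrix (Fin n) (Fin n) ℝ => (N *ᵥ x) ⬝ᵥ (X *ᵥ (N *ᵥ y)) := by
    fun_prop
  have h := (hc.tendsto 0).comp hM
  rw [Matrix.zero_mulVec, zero_dotProduct] at h
  exact h

/-- The integral of the quadratic form of `W` along the trajectories of `x' = M x` is the quadratic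
form of the solution `X` of the Lyapunov equation `Mᵀ X + X M = -W`. -/
theorem Matrix.integral_exp_smul_dotProduct
    (hM : Tendsto (fun t : ℝ => NormedSpace.exp (t • M)) atTop (𝓝 0))
    (hX : Mᵀ * X + X * M = -W) (hW : ∀ x, 0 ≤ x ⬝ᵥ (W *ᵥ x)) (x : Fin n → ℝ) :
    ∫ t in Ioi (0 : ℝ), (NormedSpace.exp (t • M) *ᵥ x) ⬝ᵥ (W *ᵥ (NormedSpace.exp (t • M) *ᵥ x)) =
      x ⬝ᵥ (X *ᵥ x) := by
  have h := integral_Ioi_of_hasDerivAt_of_nonneg'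
    (fun t _ => (Matrix.hasDerivAt_exp_smul_dotProduct M X x x t).neg) (a := 0) (l := 0)
    (fun t _ => by
      rw [hX, Matrix.neg_mulVec, dotProduct_neg, neg_neg]
      exact hW _) (by rw [← neg_zero]; exact (Matrix.tendsto_exp_smul_dotProduct hM X x x).neg)
  simpa [hX, Matrix.neg_mulVec] using h

theorem Matrix.lyapunov_dotProduct_nonneg
    (hM : Tendsto (fun t : ℝ => NormedSpace.exp (t • M)) atTop (𝓝 0))
    (hX : Mᵀ * X + X * M = -W) (hW : ∀ x, 0 ≤ x ⬝ᵥ (W *ᵥ x)) (x : Fin n → ℝ) :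
    0 ≤ x ⬝ᵥ (X *ᵥ x) := by
  rw [← Matrix.integral_exp_smul_dotProduct hM hX hW]
  exact integral_nonneg fun t => hW _

theorem Matrix.eq_zero_of_lyapunov_eq_zero
    (hM : Tendsto (fun t : ℝ => NormedSpace.exp (t • M)) atTop (𝓝 0))
    (hX : Mᵀ * X + X * M = 0) : X = 0 := by
  have key : ∀ x y : Fin n → ℝ, x ⬝ᵥ (X *ᵥ y) = 0 := by
    intro x y
    have hconst := is_const_of_deriv_eq_zero
      (f := fun t : ℝ => (NormedSpace.exp (t • M) *ᵥ x) ⬝ᵥ (X *ᵥ (NormedSpace.exp (t • M) *ᵥ y)))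
      (fun t => (Matrix.hasDerivAt_exp_smul_dotProduct M X x y t).differentiableAt)
      (fun t => by rw [(Matrix.hasDerivAt_exp_smul_dotProduct M X x y t).deriv, hX]; simp)
    have h0 : ∀ t : ℝ, x ⬝ᵥ (X *ᵥ y) =
        (NormedSpace.exp (t • M) *ᵥ x) ⬝ᵥ (X *ᵥ (NormedSpace.exp (t • M) *ᵥ y)) := fun t => by
      simpa using hconst 0 t
    exact tendsto_nhds_unique (tendsto_const_nhds.congr h0)
      (Matrix.tendsto_exp_smul_dotProduct hM X x y)
  ext i j
  simpa using key (Pi.single i 1) (Pi.single j 1)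

/-- The Lyapunov operator `X ↦ Mᵀ X + X M`, as a linear function of `M`. -/
def lyapunovOp (n : ℕ) : Matrix (Fin n) (Fin n) ℝ →ₗ[ℝ] Module.End ℝ (Matrix (Fin n) (Fin n) ℝ) :=
  LinearMap.mk₂ ℝ (fun M X => Mᵀ * X + X * M)
    (fun M N X => by simp only [Matrix.transpose_add, Matrix.add_mul, Matrix.mul_add]; abel)
    (fun c M X => by simp)
    (fun M X Y => by simp only [Matrix.add_mul, Matrix.mul_add]; abel)
    (fun c M X => by simp)

@[simp]
theorem lyapunovOp_apply (M X : Matrix (Fin n) (Fin n) ℝ) :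
    lyapunovOp n M X = Mᵀ * X + X * M := rfl

/-- The solution `X` of the Lyapunov equation `Mᵀ X + X M = -W`; it is `0` by convention if the
Lyapunov operator of `M` is not invertible. -/
noncomputable def lyapunovSol (M W : Matrix (Fin n) (Fin n) ℝ) : Matrix (Fin n) (Fin n) ℝ :=
  -(Ring.inverse (lyapunovOp n M)) W

theorem isUnit_lyapunovOp (hM : Tendsto (fun t : ℝ => NormedSpace.exp (t • M)) atTop (𝓝 0)) :
    IsUnit (lyapunovOp n M) := by
  rw [LinearMap.isUnit_iff_ker_eq_bot, LinearMap.ker_eq_bot']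
  exact fun X hX => Matrix.eq_zero_of_lyapunov_eq_zero hM hX

theorem lyapunovSol_spec (hM : Tendsto (fun t : ℝ => NormedSpace.exp (t • M)) atTop (𝓝 0))
    (W : Matrix (Fin n) (Fin n) ℝ) : Mᵀ * lyapunovSol M W + lyapunovSol M W * M = -W := by
  rw [← lyapunovOp_apply, lyapunovSol, map_neg, ← Module.End.mul_apply,
    Ring.mul_inverse_cancel _ (isUnit_lyapunovOp hM), Module.End.one_apply]

theorem lyapunovSol_unique (hM : Tendsto (fun t : ℝ => NormedSpace.exp (t • M)) atTop (𝓝 0))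
    (hX : Mᵀ * X + X * M = -W) : X = lyapunovSol M W := by
  rw [← sub_eq_zero]
  refine Matrix.eq_zero_of_lyapunov_eq_zero hM ?_
  have h := lyapunovSol_spec hM W
  rw [Matrix.mul_sub, Matrix.sub_mul, sub_add_sub_comm, hX, h, sub_self]

theorem lyapunovSol_transpose (hM : Tendsto (fun t : ℝ => NormedSpace.exp (t • M)) atTop (𝓝 0))
    (hW : Wᵀ = W) : (lyapunovSol M W)ᵀ = lyapunovSol M W := by
  refine lyapunovSol_unique hM ?_
  have h := congrArg Matrix.transpose (lyapunovSol_spec hM W)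
  rw [Matrix.transpose_add, Matrix.transpose_mul, Matrix.transpose_mul, Matrix.transpose_transpose,
    Matrix.transpose_neg, hW, add_comm] at h
  exact h

/-- The solution of an invertible linear equation is a smooth function of the data. -/
theorem ContDiffAt.ringInverse_apply {E F G : Type*} [NormedAddCommGroup E] [NormedSpace ℝ E]
    [NormedAddCommGroup F] [NormedSpace ℝ F] [FiniteDimensional ℝ F]
    [NormedAddCommGroup G] [NormedSpace ℝ G] [FiniteDimensional ℝ G]
    (L : F →ₗ[ℝ] Module.End ℝ G) {k : WithTop ℕ∞} {M : E → F} {W : E → G} {x : E}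
    (hx : IsUnit (L (M x))) (hM : ContDiffAt ℝ k M x) (hW : ContDiffAt ℝ k W x) :
    ContDiffAt ℝ k (fun y => Ring.inverse (L (M y)) (W y)) x := by
  have : CompleteSpace G := FiniteDimensional.complete ℝ G
  let e := Module.End.toContinuousLinearMap (𝕜 := ℝ) G
  have he : ∀ y, Ring.inverse (L (M y)) (W y) = Ring.inverse (e (L (M y))) (W y) := fun y => by
    have hinv : e (Ring.inverse (L (M y))) = Ring.inverse (e (L (M y))) := by
      by_cases h : IsUnit (L (M y))
      · obtain ⟨u, hu⟩ := h
        have hu' : e u = (Units.map (e : Module.End ℝ G →* (G →L[ℝ] G)) u) := rfl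
        rw [← hu, Ring.inverse_unit, hu', Ring.inverse_unit]
        rfl
      · rw [Ring.inverse_non_unit _ h, map_zero, Ring.inverse_non_unit]
        rwa [MulEquiv.isUnit_map]
    rw [← hinv]
    rfl
  obtain ⟨u, hu⟩ := hx.map e
  have h1 : ContDiffAt ℝ k (fun y => e (L (M y))) x :=
    (LinearMap.toContinuousLinearMap (e.toLinearMap ∘ₗ L)).contDiff.contDiffAt.comp x hM
  have h2 : ContDiffAt ℝ k Ring.inverse (e (L (M x))) := hu ▸ contDiffAt_ringInverse ℝ u
  simp only [he]
  exact (h2.comp x h1).clm_apply hW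

theorem ContDiffAt.lyapunovSol {E : Type*} [NormedAddCommGroup E] [NormedSpace ℝ E]
    {k : WithTop ℕ∞} {M W : E → Matrix (Fin n) (Fin n) ℝ} {x : E}
    (hM : Tendsto (fun t : ℝ => NormedSpace.exp (t • M x)) atTop (𝓝 0))
    (hMd : ContDiffAt ℝ k M x) (hWd : ContDiffAt ℝ k W x) :
    ContDiffAt ℝ k (fun y => lyapunovSol (M y) (W y)) x :=
  (ContDiffAt.ringInverse_apply (lyapunovOp n) (isUnit_lyapunovOp hM) hMd hWd).neg

/-- Duality of the Lyapunov equations of `M` and `Mᵀ`. -/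
theorem trace_mul_eq_of_lyapunov {Y T : Matrix (Fin n) (Fin n) ℝ}
    (hX : Mᵀ * X + X * M = -W) (hY : M * Y + Y * Mᵀ = -T) : (X * T).trace = (W * Y).trace := by
  have h1 : T = -(M * Y + Y * Mᵀ) := by rw [hY, neg_neg]
  have h2 : W = -(Mᵀ * X + X * M) := by rw [hX, neg_neg]
  rw [h1, h2, Matrix.mul_neg, Matrix.neg_mul, Matrix.trace_neg, Matrix.trace_neg, Matrix.mul_add,
    Matrix.add_mul, Matrix.trace_add, Matrix.trace_add, ← Matrix.mul_assoc, ← Matrix.mul_assoc,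
    Matrix.trace_mul_comm (X * Y), ← Matrix.mul_assoc, Matrix.mul_assoc X M Y, add_comm]

/-- The Lyapunov criterion: `M` is Hurwitz if `Mᵀ X + X M` is negative definite for some positive
semidefinite `X`. For an eigenvector `a + i b`, the real part of the eigenvalue is read off by adding
the values of the quadratic form of `Mᵀ X + X M` at `a` and at `b`. -/
theorem re_neg_of_lyapunov (hX : Mᵀ * X + X * M = -W) (hX0 : ∀ x, 0 ≤ x ⬝ᵥ (X *ᵥ x))
    (hW : ∀ x, x ≠ 0 → 0 < x ⬝ᵥ (W *ᵥ x)) :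
    ∀ s ∈ spectrum ℂ (M.map (algebraMap ℝ ℂ)), s.re < 0 := by
  intro s hs
  obtain ⟨v, hv0, hv⟩ := Matrix.mem_spectrum_iff_exists_mulVec.1 hs
  set a : Fin n → ℝ := fun i => (v i).re with ha
  set b : Fin n → ℝ := fun i => (v i).im with hb
  have hMa : M *ᵥ a = s.re • a - s.im • b := by
    ext i
    have := congrArg Complex.re (congrFun hv i)
    simpa [Matrix.mulVec, dotProduct, ha, hb] using this
  have hMb : M *ᵥ b = s.im • a + s.re • b := by
    ext i
    have := congrArg Complex.im (congrFun hv i)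
    simpa [Matrix.mulVec, dotProduct, ha, hb, add_comm] using this
  have hform : ∀ x : Fin n → ℝ,
      (M *ᵥ x) ⬝ᵥ (X *ᵥ x) + x ⬝ᵥ (X *ᵥ (M *ᵥ x)) = -(x ⬝ᵥ (W *ᵥ x)) := by
    intro x
    rw [← dotProduct_neg, ← Matrix.neg_mulVec, ← hX, Matrix.add_mulVec, dotProduct_add,
      ← Matrix.mulVec_mulVec, ← Matrix.mulVec_mulVec, Matrix.dotProduct_mulVec _ Mᵀ,
      Matrix.vecMul_transpose]
  have h1 := hform a
  have h2 := hform b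
  simp only [hMa, hMb, Matrix.mulVec_sub, Matrix.mulVec_add, Matrix.mulVec_smul, sub_dotProduct,
    add_dotProduct, smul_dotProduct, dotProduct_sub, dotProduct_add, dotProduct_smul,
    smul_eq_mul] at h1 h2
  have hW0 : ∀ x, 0 ≤ x ⬝ᵥ (W *ᵥ x) := fun x => by
    rcases eq_or_ne x 0 with rfl | h
    exacts [by simp, (hW x h).le]
  have hpos : 0 < a ⬝ᵥ (W *ᵥ a) + b ⬝ᵥ (W *ᵥ b) := by
    by_cases ha0 : a = 0
    · have hb0 : b ≠ 0 := fun hb0 => hv0 <| by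
        ext i
        exact Complex.ext (congrFun ha0 i) (congrFun hb0 i)
      linarith [hW0 a, hW b hb0]
    · linarith [hW0 b, hW a ha0]
  have hsum : 2 * s.re * (a ⬝ᵥ (X *ᵥ a) + b ⬝ᵥ (X *ᵥ b)) < 0 := by linarith
  by_contra hre
  have := mul_nonneg (not_lt.1 hre) (add_nonneg (hX0 a) (hX0 b))
  linarith

end LyapunovEquation

/-! ### Positive semidefinite matrices and the Frobenius norm -/

section PosSemidef

variable {n m : ℕ}

theorem frobeniusInner_eq_trace (X Y : Matrix (Fin m) (Fin n) ℝ) :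
    inner ℝ X Y = (Xᵀ * Y).trace := rfl

theorem trace_transpose_mul_self_eq_norm_sq (X : Matrix (Fin m) (Fin n) ℝ) :
    (Xᵀ * X).trace = ‖X‖ ^ 2 := by
  rw [← frobeniusInner_eq_trace, real_inner_self_eq_norm_sq]

open scoped MatrixOrder in
theorem Matrix.PosSemidef.exists_eq_transpose_mul_self {X : Matrix (Fin n) (Fin n) ℝ}
    (hX : X.PosSemidef) : ∃ C : Matrix (Fin n) (Fin n) ℝ, X = Cᵀ * C := by
  obtain ⟨C, hC⟩ := CStarAlgebra.nonneg_iff_eq_star_mul_self.mp hX.nonneg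
  exact ⟨C, by rw [hC, Matrix.star_eq_conjTranspose, Matrix.conjTranspose_eq_transpose_of_trivial]⟩

theorem Matrix.PosDef.exists_eq_transpose_mul_self {X : Matrix (Fin n) (Fin n) ℝ}
    (hX : X.PosDef) : ∃ C : Matrix (Fin n) (Fin n) ℝ, IsUnit C.det ∧ X = Cᵀ * C := by
  obtain ⟨C, hC⟩ := hX.posSemidef.exists_eq_transpose_mul_self
  refine ⟨C, ?_, hC⟩
  have h := (Matrix.isUnit_iff_isUnit_det _).1 hX.isUnit
  rw [hC, Matrix.det_mul] at h
  exact isUnit_of_mul_isUnit_right h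

theorem Matrix.PosSemidef.norm_le_trace {X : Matrix (Fin n) (Fin n) ℝ} (hX : X.PosSemidef) :
    ‖X‖ ≤ X.trace := by
  obtain ⟨C, rfl⟩ := hX.exists_eq_transpose_mul_self
  rw [trace_transpose_mul_self_eq_norm_sq]
  refine (Matrix.frobenius_norm_mul _ _).trans ?_
  rw [Matrix.frobenius_norm_transpose, sq]

theorem Matrix.PosSemidef.trace_mul_nonneg {X Y : Matrix (Fin n) (Fin n) ℝ} (hX : X.PosSemidef)
    (hY : Y.PosSemidef) : 0 ≤ (X * Y).trace := by
  obtain ⟨C, rfl⟩ := hY.exists_eq_transpose_mul_self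
  rw [← Matrix.mul_assoc, Matrix.trace_mul_comm, ← Matrix.mul_assoc,
    ← Matrix.conjTranspose_eq_transpose_of_trivial]
  exact (hX.mul_mul_conjTranspose_same C).trace_nonneg

/-- `X ↦ tr (X Y)` dominates the norm on positive semidefinite matrices if `Y` is positive
definite. -/
theorem Matrix.PosDef.exists_norm_le_mul_trace {Y : Matrix (Fin n) (Fin n) ℝ} (hY : Y.PosDef) :
    ∃ c, 0 ≤ c ∧ ∀ X : Matrix (Fin n) (Fin n) ℝ, X.PosSemidef → ‖X‖ ≤ c * (X * Y).trace := by
  obtain ⟨C, hC, rfl⟩ := hY.exists_eq_transpose_mul_self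
  refine ⟨‖C⁻¹‖ * ‖C⁻¹‖, by positivity, fun X hX => ?_⟩
  have hCX := hX.mul_mul_conjTranspose_same C
  rw [Matrix.conjTranspose_eq_transpose_of_trivial] at hCX
  have hX' : X = C⁻¹ * (C * X * Cᵀ) * (C⁻¹)ᵀ := by
    rw [Matrix.transpose_nonsing_inv, Matrix.mul_assoc, Matrix.mul_assoc,
      Matrix.mul_nonsing_inv _ (by rwa [Matrix.det_transpose]), Matrix.mul_one,
      ← Matrix.mul_assoc, Matrix.nonsing_inv_mul _ hC, Matrix.one_mul]
  have htr : (X * (Cᵀ * C)).trace = (C * X * Cᵀ).trace := by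
    rw [← Matrix.mul_assoc, Matrix.trace_mul_comm, ← Matrix.mul_assoc]
  calc ‖X‖ = ‖C⁻¹ * (C * X * Cᵀ) * (C⁻¹)ᵀ‖ := by rw [← hX']
    _ ≤ ‖C⁻¹‖ * ‖C * X * Cᵀ‖ * ‖(C⁻¹)ᵀ‖ :=
        (Matrix.frobenius_norm_mul _ _).trans
          (mul_le_mul_of_nonneg_right (Matrix.frobenius_norm_mul _ _) (norm_nonneg _))
    _ = ‖C⁻¹‖ * ‖C⁻¹‖ * ‖C * X * Cᵀ‖ := by rw [Matrix.frobenius_norm_transpose]; ring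
    _ ≤ ‖C⁻¹‖ * ‖C⁻¹‖ * (X * (Cᵀ * C)).trace := by
        rw [htr]
        gcongr
        exact hCX.norm_le_trace

theorem Matrix.PosDef.exists_norm_sq_le_mul_trace {R : Matrix (Fin m) (Fin m) ℝ} (hR : R.PosDef)
    (n : ℕ) :
    ∃ c, 0 ≤ c ∧ ∀ K : Matrix (Fin m) (Fin n) ℝ, ‖K‖ ^ 2 ≤ c * (Kᵀ * R * K).trace := by
  obtain ⟨D, hD, rfl⟩ := hR.exists_eq_transpose_mul_self
  refine ⟨‖D⁻¹‖ ^ 2, by positivity, fun K => ?_⟩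
  have h1 : (Kᵀ * (Dᵀ * D) * K).trace = ‖D * K‖ ^ 2 := by
    rw [← trace_transpose_mul_self_eq_norm_sq, Matrix.transpose_mul]
    simp only [Matrix.mul_assoc]
  have h2 : K = D⁻¹ * (D * K) := by
    rw [← Matrix.mul_assoc, Matrix.nonsing_inv_mul _ hD, Matrix.one_mul]
  rw [h1, ← mul_pow]
  refine pow_le_pow_left₀ (norm_nonneg _) ?_ 2
  calc ‖K‖ = ‖D⁻¹ * (D * K)‖ := by rw [← h2]
    _ ≤ _ := Matrix.frobenius_norm_mul _ _

theorem abs_trace_le (X : Matrix (Fin n) (Fin n) ℝ) :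
    |X.trace| ≤ ‖(1 : Matrix (Fin n) (Fin n) ℝ)‖ * ‖X‖ := by
  have h := abs_real_inner_le_norm (1 : Matrix (Fin n) (Fin n) ℝ) X
  rwa [frobeniusInner_eq_trace, Matrix.transpose_one, Matrix.one_mul] at h

theorem posSemidef_transpose_mul_mul {R : Matrix (Fin m) (Fin m) ℝ} (hR : R.PosSemidef)
    (K : Matrix (Fin m) (Fin n) ℝ) : (Kᵀ * R * K).PosSemidef := by
  rw [← Matrix.conjTranspose_eq_transpose_of_trivial]
  exact hR.conjTranspose_mul_mul_same K

/-- Positive definiteness is stable under small perturbations, by compactness of the sphere. -/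
theorem eventually_forall_dotProduct_mulVec_pos {Z : Type*} [TopologicalSpace Z]
    {W : Z → Matrix (Fin n) (Fin n) ℝ} (hW : Continuous W) {z : Z}
    (hz : ∀ x, x ≠ 0 → 0 < x ⬝ᵥ (W z *ᵥ x)) :
    ∀ᶠ y in 𝓝 z, ∀ x, x ≠ 0 → 0 < x ⬝ᵥ (W y *ᵥ x) := by
  have hc : Continuous fun p : Z × (Fin n → ℝ) => p.2 ⬝ᵥ (W p.1 *ᵥ p.2) :=
    continuous_snd.dotProduct ((hW.comp continuous_fst).matrix_mulVec continuous_snd)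
  have h := (isCompact_sphere (0 : Fin n → ℝ) 1).eventually_forall_of_forall_eventually
    (x₀ := z) (P := fun y x => 0 < x ⬝ᵥ (W y *ᵥ x)) fun x hx =>
      hc.continuousAt.eventually (lt_mem_nhds (hz x (by
        rintro rfl
        simp at hx)))
  filter_upwards [h] with y hy x hx
  have hx0 : 0 < ‖x‖ := norm_pos_iff.2 hx
  have h1 := hy (‖x‖⁻¹ • x) (by simp [norm_smul, hx0.ne'])
  rw [Matrix.mulVec_smul, smul_dotProduct, dotProduct_smul, smul_eq_mul, smul_eq_mul,
    ← mul_assoc] at h1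
  exact pos_of_mul_pos_right h1 (by positivity)

end PosSemidef

/-! ### Smoothness of matrix operations -/

section Smooth

variable {E : Type*} [NormedAddCommGroup E] [NormedSpace ℝ E] {k : WithTop ℕ∞} {x : E} {l m n : ℕ}

theorem ContDiffAt.matrix_mul {f : E → Matrix (Fin l) (Fin m) ℝ} {g : E → Matrix (Fin m) (Fin n) ℝ}
    (hf : ContDiffAt ℝ k f x) (hg : ContDiffAt ℝ k g x) :
    ContDiffAt ℝ k (fun y => f y * g y) x := by
  have hb : IsBoundedBilinearMap ℝ
      fun p : Matrix (Fin l) (Fin m) ℝ × Matrix (Fin m) (Fin n) ℝ => p.1 * p.2 :=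
    { add_left := fun X Y Z => Matrix.add_mul X Y Z
      smul_left := fun c X Y => Matrix.smul_mul c X Y
      add_right := fun X Y Z => Matrix.mul_add X Y Z
      smul_right := fun c X Y => Matrix.mul_smul X c Y
      bound := ⟨1, one_pos, fun X Y => by
        rw [one_mul]
        exact Matrix.frobenius_norm_mul X Y⟩ }
  exact hb.contDiff.contDiffAt.comp x (hf.prodMk hg)

theorem ContDiffAt.matrix_transpose {f : E → Matrix (Fin l) (Fin m) ℝ} (hf : ContDiffAt ℝ k f x) :
    ContDiffAt ℝ k (fun y => (f y)ᵀ) x :=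
  (LinearMap.toContinuousLinearMap
    (Matrix.transposeLinearEquiv (Fin l) (Fin m) ℝ ℝ).toLinearMap).contDiff.contDiffAt.comp x hf

theorem ContDiffAt.matrix_trace {f : E → Matrix (Fin n) (Fin n) ℝ} (hf : ContDiffAt ℝ k f x) :
    ContDiffAt ℝ k (fun y => (f y).trace) x :=
  (LinearMap.toContinuousLinearMap
    (Matrix.traceLinearMap (Fin n) ℝ ℝ)).contDiff.contDiffAt.comp x hf

end Smooth

/-! ### The cost in terms of Lyapunov equations -/

section SLQR

variable {n m : ℕ} {A : Matrix (Fin n) (Fin n) ℝ} {B : Matrix (Fin n) (Fin m) ℝ}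
  {Q : Matrix (Fin n) (Fin n) ℝ} {R : Matrix (Fin m) (Fin m) ℝ} {Sig : Matrix (Fin n) (Fin n) ℝ}
  {μ : Measure (Fin n → ℝ)} {K : Matrix (Fin m) (Fin n) ℝ}

/-- The cost matrix `P` of the gain `K`: `x₀ᵀ P x₀` is the cost of the closed loop started
at `x₀`. -/
noncomputable def costMatrix (A : Matrix (Fin n) (Fin n) ℝ) (B : Matrix (Fin n) (Fin m) ℝ)
    (Q : Matrix (Fin n) (Fin n) ℝ) (R : Matrix (Fin m) (Fin m) ℝ) (K : Matrix (Fin m) (Fin n) ℝ) :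
    Matrix (Fin n) (Fin n) ℝ :=
  lyapunovSol (A - B * K) (Q + Kᵀ * R * K)

/-- The Gramian `Y` of the gain `K`: the time integral of the covariance of the state. -/
noncomputable def gramian (A : Matrix (Fin n) (Fin n) ℝ) (B : Matrix (Fin n) (Fin m) ℝ)
    (Sig : Matrix (Fin n) (Fin n) ℝ) (K : Matrix (Fin m) (Fin n) ℝ) : Matrix (Fin n) (Fin n) ℝ :=
  lyapunovSol (A - B * K)ᵀ Sig

/-- The residual `R K - Bᵀ P`; among stabilizing gains it vanishes only at the optimal one. -/
noncomputable def gainResidual (A : Matrix (Fin n) (Fin n) ℝ) (B : Matrix (Fin n) (Fin m) ℝ)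
    (Q : Matrix (Fin n) (Fin n) ℝ) (R : Matrix (Fin m) (Fin m) ℝ) (K : Matrix (Fin m) (Fin n) ℝ) :
    Matrix (Fin m) (Fin n) ℝ :=
  R * K - Bᵀ * costMatrix A B Q R K

theorem tendsto_exp_of_mem_stabilizingGains (hK : K ∈ stabilizingGains A B) :
    Tendsto (fun t : ℝ => NormedSpace.exp (t • (A - B * K))) atTop (𝓝 0) :=
  Matrix.tendsto_exp_smul_of_spectrum hK

theorem tendsto_exp_transpose_of_mem_stabilizingGains (hK : K ∈ stabilizingGains A B) :
    Tendsto (fun t : ℝ => NormedSpace.exp (t • (A - B * K)ᵀ)) atTop (𝓝 0) := by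
  have hc : Continuous fun X : Matrix (Fin n) (Fin n) ℝ => Xᵀ := continuous_id.matrix_transpose
  have h := (hc.tendsto 0).comp (tendsto_exp_of_mem_stabilizingGains hK)
  rw [Matrix.transpose_zero] at h
  refine h.congr fun t => ?_
  rw [Function.comp_apply, ← Matrix.exp_transpose, Matrix.transpose_smul]

theorem posDef_add_transpose_mul_mul (hQ : Q.PosDef) (hR : R.PosDef)
    (K : Matrix (Fin m) (Fin n) ℝ) : (Q + Kᵀ * R * K).PosDef :=
  hQ.add_posSemidef (posSemidef_transpose_mul_mul hR.posSemidef K)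

theorem costMatrix_spec (hK : K ∈ stabilizingGains A B) :
    (A - B * K)ᵀ * costMatrix A B Q R K + costMatrix A B Q R K * (A - B * K) =
      -(Q + Kᵀ * R * K) :=
  lyapunovSol_spec (tendsto_exp_of_mem_stabilizingGains hK) _

theorem gramian_spec (hK : K ∈ stabilizingGains A B) :
    (A - B * K) * gramian A B Sig K + gramian A B Sig K * (A - B * K)ᵀ = -Sig := by
  have h := lyapunovSol_spec (tendsto_exp_transpose_of_mem_stabilizingGains hK) Sig
  rw [Matrix.transpose_transpose] at h
  exact h

theorem posSemidef_lyapunovSol {M W : Matrix (Fin n) (Fin n) ℝ}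
    (hM : Tendsto (fun t : ℝ => NormedSpace.exp (t • M)) atTop (𝓝 0)) (hW : W.PosSemidef) :
    (lyapunovSol M W).PosSemidef := by
  refine Matrix.PosSemidef.of_dotProduct_mulVec_nonneg ?_ fun x => ?_
  · exact lyapunovSol_transpose hM hW.isHermitian
  · exact Matrix.lyapunov_dotProduct_nonneg hM (lyapunovSol_spec hM W)
      (fun y => hW.dotProduct_mulVec_nonneg y) x

theorem posSemidef_costMatrix (hQ : Q.PosDef) (hR : R.PosDef) (hK : K ∈ stabilizingGains A B) :
    (costMatrix A B Q R K).PosSemidef :=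
  posSemidef_lyapunovSol (tendsto_exp_of_mem_stabilizingGains hK)
    (posDef_add_transpose_mul_mul hQ hR K).posSemidef

theorem posDef_gramian (hSig : Sig.PosDef) (hK : K ∈ stabilizingGains A B) :
    (gramian A B Sig K).PosDef := by
  have hY : (gramian A B Sig K).PosSemidef :=
    posSemidef_lyapunovSol (tendsto_exp_transpose_of_mem_stabilizingGains hK) hSig.posSemidef
  refine Matrix.PosDef.of_dotProduct_mulVec_pos hY.isHermitian fun x hx => ?_
  refine lt_of_le_of_ne (hY.dotProduct_mulVec_nonneg x) fun h0 => ?_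
  -- a null vector of the Gramian is a null vector of `Sig`
  have hYx : gramian A B Sig K *ᵥ x = 0 := (hY.dotProduct_mulVec_zero_iff x).1 h0.symm
  have hxY : x ᵥ* gramian A B Sig K = 0 := by
    have hsymm : (gramian A B Sig K)ᵀ = gramian A B Sig K := hY.isHermitian
    rw [← hsymm, Matrix.vecMul_transpose, hYx]
  have h := congrArg (fun X => x ⬝ᵥ (X *ᵥ x)) (gramian_spec (Sig := Sig) hK)
  simp only [Matrix.add_mulVec, dotProduct_add, ← Matrix.mulVec_mulVec, hYx, Matrix.mulVec_zero,
    dotProduct_zero, Matrix.dotProduct_mulVec x (gramian A B Sig K), hxY, zero_dotProduct,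
    Matrix.neg_mulVec, dotProduct_neg, add_zero] at h
  have := hSig.dotProduct_mulVec_pos hx
  simp only [star_trivial] at this
  linarith

/-- Expectation of a quadratic form of the initial state. -/
theorem IsInitialLaw.integral_dotProduct_mulVec (hμ : IsInitialLaw μ Sig)
    (P : Matrix (Fin n) (Fin n) ℝ) (hSig : Sigᵀ = Sig) :
    ∫ x, x ⬝ᵥ (P *ᵥ x) ∂μ = (P * Sig).trace := by
  have hint : ∀ i j, Integrable (fun x : Fin n → ℝ => x i * x j) μ := fun i j =>
    (hμ.memLp i).integrable_mul (hμ.memLp j)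
  obtain ⟨p, hp⟩ : ∃ p : Fin n → Fin n → ℝ, ∀ i j, P i j = p i j := ⟨_, fun _ _ => rfl⟩
  have h1 : ∀ x : Fin n → ℝ, x ⬝ᵥ (P *ᵥ x) = ∑ i, ∑ j, p i j * (x i * x j) := fun x => by
    simp only [dotProduct, Matrix.mulVec, Finset.mul_sum, hp]
    exact Finset.sum_congr rfl fun i _ => Finset.sum_congr rfl fun j _ => by ring
  simp only [h1]
  rw [integral_finsetSum _ fun i _ => integrable_finsetSum _ fun j _ => (hint i j).const_mul _]
  simp only [Matrix.trace, Matrix.diag, Matrix.mul_apply, hp]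
  refine Finset.sum_congr rfl fun i _ => ?_
  rw [integral_finsetSum _ fun j _ => (hint i j).const_mul _]
  refine Finset.sum_congr rfl fun j _ => ?_
  rw [integral_const_mul, hμ.cov, show Sig i j = Sig j i from congrFun (congrFun hSig j) i]

theorem slqrCost_eq_trace (hQ : Q.PosDef) (hR : R.PosDef) (hSig : Sig.PosDef)
    (hμ : IsInitialLaw μ Sig) (hK : K ∈ stabilizingGains A B) :
    slqrCost A B Q R μ K = (costMatrix A B Q R K * Sig).trace := by
  rw [← hμ.integral_dotProduct_mulVec _ hSig.isHermitian, slqrCost]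
  refine integral_congr_ae (Eventually.of_forall fun x => ?_)
  refine Eq.trans ?_ (Matrix.integral_exp_smul_dotProduct (tendsto_exp_of_mem_stabilizingGains hK)
    (costMatrix_spec hK) (fun y =>
      (posDef_add_transpose_mul_mul hQ hR K).posSemidef.dotProduct_mulVec_nonneg y) x)
  refine integral_congr_ae (Eventually.of_forall fun t => ?_)
  simp only [closedLoopState]
  generalize NormedSpace.exp (t • (A - B * K)) *ᵥ x = y
  rw [Matrix.add_mulVec, dotProduct_add, Matrix.mulVec_neg, neg_dotProduct_neg,
    ← Matrix.mulVec_mulVec, ← Matrix.mulVec_mulVec, Matrix.dotProduct_mulVec y Kᵀ,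
    Matrix.vecMul_transpose]

/-! ### The set of stabilizing gains -/

theorem isOpen_stabilizingGains (A : Matrix (Fin n) (Fin n) ℝ) (B : Matrix (Fin n) (Fin m) ℝ) :
    IsOpen (stabilizingGains A B) := by
  rw [isOpen_iff_mem_nhds]
  intro K hK
  -- the solution `X` of the Lyapunov equation at `K` is a Lyapunov certificate near `K`
  set X := costMatrix A B 1 1 K
  have hX := posSemidef_costMatrix (A := A) (B := B) (Q := 1) (R := 1) .one .one hK
  have hc : Continuous fun L : Matrix (Fin m) (Fin n) ℝ =>
      -((A - B * L)ᵀ * X + X * (A - B * L)) := by fun_prop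
  filter_upwards [eventually_forall_dotProduct_mulVec_pos hc (z := K) fun x hx => by
    rw [costMatrix_spec hK, neg_neg]
    exact (posDef_add_transpose_mul_mul .one .one K).dotProduct_mulVec_pos hx] with L hL
  exact re_neg_of_lyapunov (neg_neg _).symm (fun x => hX.dotProduct_mulVec_nonneg x) hL

/-- Coercivity of the cost. A sublevel set is the projection of the set of pairs `(K, P)` with `P`
positive semidefinite, `(A - B K)ᵀ P + P (A - B K) = -(Q + Kᵀ R K)` and `tr (P Sig) ≤ c`.
The last condition bounds `P`, and then the equation, being quadratic in `K`, bounds `K`. -/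
theorem isCompact_slqrCost_sublevel (hQ : Q.PosDef) (hR : R.PosDef) (hSig : Sig.PosDef)
    (hμ : IsInitialLaw μ Sig) (c : ℝ) :
    IsCompact {K | K ∈ stabilizingGains A B ∧ slqrCost A B Q R μ K ≤ c} := by
  set D : Set (Matrix (Fin m) (Fin n) ℝ × Matrix (Fin n) (Fin n) ℝ) :=
    {z | z.2.PosSemidef ∧ (A - B * z.1)ᵀ * z.2 + z.2 * (A - B * z.1) = -(Q + z.1ᵀ * R * z.1) ∧
      (z.2 * Sig).trace ≤ c} with hD
  have hproj : {K | K ∈ stabilizingGains A B ∧ slqrCost A B Q R μ K ≤ c} = Prod.fst '' D := by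
    ext K
    constructor
    · rintro ⟨hK, hc⟩
      rw [slqrCost_eq_trace hQ hR hSig hμ hK] at hc
      exact ⟨(K, costMatrix A B Q R K), ⟨posSemidef_costMatrix hQ hR hK, costMatrix_spec hK, hc⟩,
        rfl⟩
    · rintro ⟨⟨K, P⟩, ⟨hP, hlyap, hc⟩, rfl⟩
      have hK : K ∈ stabilizingGains A B :=
        re_neg_of_lyapunov hlyap (fun x => hP.dotProduct_mulVec_nonneg x)
          fun x hx => (posDef_add_transpose_mul_mul hQ hR K).dotProduct_mulVec_pos hx
      refine ⟨hK, ?_⟩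
      rw [slqrCost_eq_trace hQ hR hSig hμ hK]
      have hPK : P = costMatrix A B Q R K :=
        lyapunovSol_unique (tendsto_exp_of_mem_stabilizingGains hK) hlyap
      rw [← hPK]
      exact hc
  have hclosed : IsClosed D := by
    have h1 : IsClosed {z : Matrix (Fin m) (Fin n) ℝ × Matrix (Fin n) (Fin n) ℝ |
        z.2ᵀ = z.2 ∧ ∀ x : Fin n → ℝ, 0 ≤ x ⬝ᵥ (z.2 *ᵥ x)} := by
      refine IsClosed.and (isClosed_eq (by fun_prop) (by fun_prop)) ?_
      simp only [ofPred_forall]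
      exact isClosed_iInter fun x => isClosed_le (by fun_prop) (by fun_prop)
    have h2 : IsClosed {z : Matrix (Fin m) (Fin n) ℝ × Matrix (Fin n) (Fin n) ℝ |
        (A - B * z.1)ᵀ * z.2 + z.2 * (A - B * z.1) = -(Q + z.1ᵀ * R * z.1)} :=
      isClosed_eq (by fun_prop) (by fun_prop)
    have h3 : IsClosed {z : Matrix (Fin m) (Fin n) ℝ × Matrix (Fin n) (Fin n) ℝ |
        (z.2 * Sig).trace ≤ c} := isClosed_le (by fun_prop) (by fun_prop)
    convert h1.inter (h2.inter h3) using 1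
    ext z
    simp only [hD, mem_ofPred_eq, mem_inter_iff, Matrix.posSemidef_iff_dotProduct_mulVec,
      Matrix.IsHermitian, Matrix.conjTranspose_eq_transpose_of_trivial, star_trivial]
  have hbdd : Bornology.IsBounded D := by
    obtain ⟨c₁, hc₁, hP⟩ := hSig.exists_norm_le_mul_trace
    obtain ⟨c₂, hc₂, hKR⟩ := hR.exists_norm_sq_le_mul_trace n
    set ν := ‖(1 : Matrix (Fin n) (Fin n) ℝ)‖
    have hν : 0 ≤ ν := norm_nonneg _
    set p := c₁ * max c 0 with hp
    have hp0 : 0 ≤ p := mul_nonneg hc₁ (le_max_right _ _)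
    set a := c₂ * (ν * (2 * p * ‖B‖)) with ha
    set b := c₂ * (ν * (2 * ‖A‖ * p + ‖Q‖)) with hb
    have ha0 : 0 ≤ a := by positivity
    have hb0 : 0 ≤ b := by positivity
    refine (Metric.isBounded_closedBall (x := (0 : Matrix (Fin m) (Fin n) ℝ × _))
      (r := max (a + b + 1) p)).subset ?_
    rintro ⟨K, P⟩ ⟨hPpos, hlyap, hc⟩
    have hPp : ‖P‖ ≤ p := (hP P hPpos).trans
      (mul_le_mul_of_nonneg_left (hc.trans (le_max_left _ _)) hc₁)
    have hKeq : Kᵀ * R * K = -(Aᵀ * P + P * A + Q) + ((B * K)ᵀ * P + P * (B * K)) := by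
      have : Kᵀ * R * K = -((A - B * K)ᵀ * P + P * (A - B * K)) - Q := by
        rw [hlyap]
        abel
      rw [this, Matrix.transpose_sub, Matrix.sub_mul, Matrix.mul_sub]
      abel
    have hmulP : ∀ X : Matrix (Fin n) (Fin n) ℝ, ‖Xᵀ * P + P * X‖ ≤ 2 * ‖X‖ * p := fun X => by
      calc ‖Xᵀ * P + P * X‖ ≤ ‖Xᵀ * P‖ + ‖P * X‖ := norm_add_le _ _
        _ ≤ ‖Xᵀ‖ * ‖P‖ + ‖P‖ * ‖X‖ :=
            add_le_add (Matrix.frobenius_norm_mul _ _) (Matrix.frobenius_norm_mul _ _)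
        _ = 2 * ‖X‖ * ‖P‖ := by rw [Matrix.frobenius_norm_transpose]; ring
        _ ≤ 2 * ‖X‖ * p := by gcongr
    have hnorm : ‖Kᵀ * R * K‖ ≤ (2 * ‖A‖ * p + ‖Q‖) + 2 * (‖B‖ * ‖K‖) * p := by
      rw [hKeq]
      refine (norm_add_le _ _).trans (add_le_add ?_ ?_)
      · rw [norm_neg]
        exact (norm_add_le _ _).trans (add_le_add_left (hmulP A) _)
      · refine (hmulP (B * K)).trans ?_
        gcongr
        exact Matrix.frobenius_norm_mul _ _
    have hquad : ‖K‖ ^ 2 ≤ a * ‖K‖ + b := by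
      calc ‖K‖ ^ 2 ≤ c₂ * (Kᵀ * R * K).trace := hKR K
        _ ≤ c₂ * (ν * ((2 * ‖A‖ * p + ‖Q‖) + 2 * (‖B‖ * ‖K‖) * p)) := by
            gcongr
            exact (le_abs_self _).trans ((abs_trace_le _).trans (by gcongr))
        _ = a * ‖K‖ + b := by rw [ha, hb]; ring
    have hKb : ‖K‖ ≤ a + b + 1 := by
      by_contra! hlt
      nlinarith [norm_nonneg K]
    rw [mem_closedBall_zero_iff, Prod.norm_def]
    exact max_le_max hKb hPp
  rw [hproj]
  exact (Metric.isCompact_of_isClosed_isBounded hclosed hbdd).image continuous_fst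

/-! ### Comparison of two gains and the gradient of the cost -/

/-- The difference of the costs of two stabilizing gains, in terms of the residual of the first and
the Gramian of the second. -/
theorem slqrCost_sub_slqrCost (hQ : Q.PosDef) (hR : R.PosDef) (hSig : Sig.PosDef)
    (hμ : IsInitialLaw μ Sig) {L : Matrix (Fin m) (Fin n) ℝ} (hK : K ∈ stabilizingGains A B)
    (hL : L ∈ stabilizingGains A B) :
    slqrCost A B Q R μ L - slqrCost A B Q R μ K =
      (((L - K)ᵀ * gainResidual A B Q R K + (gainResidual A B Q R K)ᵀ * (L - K) +
        (L - K)ᵀ * R * (L - K)) * gramian A B Sig L).trace := by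
  have hRs : Rᵀ = R := hR.isHermitian
  have hPs : (costMatrix A B Q R K)ᵀ = costMatrix A B Q R K :=
    (posSemidef_costMatrix hQ hR hK).isHermitian
  rw [slqrCost_eq_trace hQ hR hSig hμ hK, slqrCost_eq_trace hQ hR hSig hμ hL, ← Matrix.trace_sub,
    ← Matrix.sub_mul]
  refine trace_mul_eq_of_lyapunov (M := A - B * L) ?_ (gramian_spec hL)
  have h1 := costMatrix_spec (Q := Q) (R := R) hK
  have h2 := costMatrix_spec (Q := Q) (R := R) hL
  generalize hPdef : costMatrix A B Q R K = P at *
  generalize costMatrix A B Q R L = P' at *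
  have h3 : (A - B * L)ᵀ * P + P * (A - B * L) =
      -(Q + Kᵀ * R * K) - ((B * (L - K))ᵀ * P + P * (B * (L - K))) := by
    rw [← h1]
    simp only [Matrix.transpose_sub, Matrix.mul_sub, Matrix.sub_mul]
    abel
  calc (A - B * L)ᵀ * (P' - P) + (P' - P) * (A - B * L)
      = ((A - B * L)ᵀ * P' + P' * (A - B * L)) - ((A - B * L)ᵀ * P + P * (A - B * L)) := by
        rw [Matrix.mul_sub, Matrix.sub_mul]
        abel
    _ = _ := by
        rw [h2, h3, gainResidual, hPdef]
        simp only [Matrix.transpose_sub, Matrix.transpose_mul, Matrix.mul_sub, Matrix.sub_mul, hRs,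
          hPs, Matrix.transpose_transpose, Matrix.mul_assoc]
        abel

/-- A gain with vanishing residual is a strict minimizer of the cost. -/
theorem slqrCost_lt_of_gainResidual_eq_zero (hQ : Q.PosDef) (hR : R.PosDef) (hSig : Sig.PosDef)
    (hμ : IsInitialLaw μ Sig) {L : Matrix (Fin m) (Fin n) ℝ} (hK : K ∈ stabilizingGains A B)
    (hL : L ∈ stabilizingGains A B) (hG : gainResidual A B Q R K = 0) (hne : L ≠ K) :
    slqrCost A B Q R μ K < slqrCost A B Q R μ L := by
  have h := slqrCost_sub_slqrCost hQ hR hSig hμ hK hL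
  rw [hG, Matrix.mul_zero, Matrix.transpose_zero, Matrix.zero_mul, add_zero, zero_add] at h
  have hpsd := posSemidef_transpose_mul_mul hR.posSemidef (L - K)
  have hY := posDef_gramian hSig hL
  obtain ⟨c, hc, hbound⟩ := hY.exists_norm_le_mul_trace
  have h0 := hpsd.trace_mul_nonneg hY.posSemidef
  refine lt_of_le_of_ne (by linarith) fun heq => hne ?_
  have hzero : (L - K)ᵀ * R * (L - K) = 0 := by
    rw [← norm_le_zero_iff]
    have := hbound _ hpsd
    rwa [← h, heq, sub_self, mul_zero] at this
  obtain ⟨c', -, hbound'⟩ := hR.exists_norm_sq_le_mul_trace n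
  have := hbound' (L - K)
  rw [hzero, Matrix.trace_zero, mul_zero] at this
  rw [← sub_eq_zero, ← norm_eq_zero]
  exact pow_eq_zero_iff two_ne_zero |>.1 (le_antisymm this (sq_nonneg _))

theorem contDiffAt_costMatrix (hK : K ∈ stabilizingGains A B) :
    ContDiffAt ℝ 1 (costMatrix A B Q R) K :=
  ContDiffAt.lyapunovSol (tendsto_exp_of_mem_stabilizingGains hK)
    (contDiffAt_const.sub (contDiffAt_const.matrix_mul contDiffAt_id))
    (contDiffAt_const.add
      ((contDiffAt_id.matrix_transpose.matrix_mul contDiffAt_const).matrix_mul contDiffAt_id))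

theorem contDiffAt_gramian (hK : K ∈ stabilizingGains A B) :
    ContDiffAt ℝ 1 (gramian A B Sig) K :=
  ContDiffAt.lyapunovSol (tendsto_exp_transpose_of_mem_stabilizingGains hK)
    (contDiffAt_const.sub (contDiffAt_const.matrix_mul contDiffAt_id)).matrix_transpose
    contDiffAt_const

theorem contDiffAt_gradient (hK : K ∈ stabilizingGains A B) :
    ContDiffAt ℝ 1 (fun K => (2 : ℝ) • (gainResidual A B Q R K * gramian A B Sig K)) K :=
  (((contDiffAt_const.matrix_mul contDiffAt_id).sub
    (contDiffAt_const.matrix_mul (contDiffAt_costMatrix hK))).matrix_mul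
      (contDiffAt_gramian hK)).const_smul (2 : ℝ)

/-- The gradient of the cost is `2 (R K - Bᵀ P) Y`. Differentiability comes from the formula
`tr (P Sig)`; the value is read off from directional derivatives, for which the difference formula
needs only the continuity of the Gramian. -/
theorem hasGradientAt_slqrCost (hQ : Q.PosDef) (hR : R.PosDef) (hSig : Sig.PosDef)
    (hμ : IsInitialLaw μ Sig) (hK : K ∈ stabilizingGains A B) :
    HasGradientAt (slqrCost A B Q R μ)
      ((2 : ℝ) • (gainResidual A B Q R K * gramian A B Sig K)) K := by
  have hS := isOpen_stabilizingGains A B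
  have hdiff : DifferentiableAt ℝ (slqrCost A B Q R μ) K := by
    refine (((contDiffAt_costMatrix (Q := Q) (R := R) hK).matrix_mul
      (contDiffAt_const (c := Sig))).matrix_trace.differentiableAt one_ne_zero).congr_of_eventuallyEq
      ?_
    filter_upwards [hS.mem_nhds hK] with L hL using slqrCost_eq_trace hQ hR hSig hμ hL
  rw [hasGradientAt_iff_hasFDerivAt]
  refine hdiff.hasFDerivAt.congr_fderiv ?_
  ext V
  set G := gainResidual A B Q R K with hG
  -- the derivative along the line `K + t V`, from the formula for the difference of two costs
  have hline : Continuous fun t : ℝ => K + t • V := by fun_prop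
  have hline0 : Tendsto (fun t : ℝ => K + t • V) (𝓝 0) (𝓝 K) := by
    have := hline.tendsto 0
    rwa [zero_smul, add_zero] at this
  have h1 : HasDerivAt (fun t : ℝ => slqrCost A B Q R μ (K + t • V))
      (fderiv ℝ (slqrCost A B Q R μ) K V) 0 := by
    have hl : HasDerivAt (fun t : ℝ => K + t • V) V 0 := by
      have := ((hasDerivAt_id (0 : ℝ)).smul_const V).const_add K
      rwa [one_smul] at this
    have hd : HasFDerivAt (slqrCost A B Q R μ) (fderiv ℝ (slqrCost A B Q R μ) K)
        (K + (0 : ℝ) • V) := by simpa using hdiff.hasFDerivAt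
    exact hd.comp_hasDerivAt 0 hl
  have h2 : HasDerivAt (fun t : ℝ => slqrCost A B Q R μ (K + t • V))
      ((Vᵀ * G + Gᵀ * V) * gramian A B Sig K).trace 0 := by
    rw [hasDerivAt_iff_tendsto_slope_zero]
    have hcont : ContinuousAt (fun L => gramian A B Sig L) K :=
      (contDiffAt_gramian hK).continuousAt
    have hgram : Tendsto (fun t : ℝ => gramian A B Sig (K + t • V)) (𝓝 0)
        (𝓝 (gramian A B Sig K)) := hcont.tendsto.comp hline0
    have hprod : Continuous fun z : ℝ × Matrix (Fin n) (Fin n) ℝ =>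
        ((Vᵀ * G + Gᵀ * V + z.1 • (Vᵀ * R * V)) * z.2).trace := by fun_prop
    have hlim := (hprod.tendsto (0, gramian A B Sig K)).comp (tendsto_id.prodMk_nhds hgram)
    simp only [zero_smul, add_zero] at hlim
    refine (hlim.mono_left nhdsWithin_le_nhds).congr' ?_
    filter_upwards [nhdsWithin_le_nhds (hline0.eventually_mem (hS.mem_nhds hK)),
      self_mem_nhdsWithin] with t ht ht0
    have ht0' : t ≠ 0 := ht0
    have h := slqrCost_sub_slqrCost hQ hR hSig hμ hK ht
    rw [zero_add, zero_smul, add_zero, h, ← hG, add_sub_cancel_left, ← Matrix.trace_smul,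
      ← Matrix.smul_mul]
    simp only [Function.comp_apply, id_eq, Matrix.transpose_smul, Matrix.smul_mul, Matrix.mul_smul,
      smul_add, smul_smul, inv_mul_cancel₀ ht0', one_smul, inv_mul_cancel_left₀ ht0']
  have hYs : (gramian A B Sig K)ᵀ = gramian A B Sig K := (posDef_gramian hSig hK).isHermitian
  have h3 : ((Vᵀ * G) * gramian A B Sig K).trace = ((G * gramian A B Sig K)ᵀ * V).trace := by
    rw [← Matrix.trace_transpose, Matrix.transpose_mul, Matrix.transpose_mul, Matrix.transpose_mul,
      Matrix.transpose_transpose, Matrix.mul_assoc]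
  have h4 : ((Gᵀ * V) * gramian A B Sig K).trace = ((G * gramian A B Sig K)ᵀ * V).trace := by
    rw [Matrix.trace_mul_comm, Matrix.transpose_mul, hYs, Matrix.mul_assoc]
  have h5 : InnerProductSpace.toDual ℝ _ ((2 : ℝ) • (G * gramian A B Sig K)) V =
      (((2 : ℝ) • (G * gramian A B Sig K))ᵀ * V).trace := rfl
  rw [h1.unique h2, Matrix.add_mul, Matrix.trace_add, h3, h4]
  refine Eq.trans ?_ h5.symm
  rw [Matrix.transpose_smul, Matrix.smul_mul, Matrix.trace_smul, smul_eq_mul, two_mul]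

theorem gainResidual_eq_zero_of_gradient_eq_zero (hSig : Sig.PosDef)
    (hK : K ∈ stabilizingGains A B)
    (h : (2 : ℝ) • (gainResidual A B Q R K * gramian A B Sig K) = 0) :
    gainResidual A B Q R K = 0 := by
  have h' := (smul_eq_zero.1 h).resolve_left two_ne_zero
  have hu := (Matrix.isUnit_iff_isUnit_det _).1 (posDef_gramian hSig hK).isUnit
  rw [← Matrix.mul_nonsing_inv_cancel_right _ (gainResidual A B Q R K) hu, h', Matrix.zero_mul]

end SLQR

/-! ### Global asymptotic stability of the heavy-ball flow of the cost -/

theorem theorem4 {n m : ℕ} (A : Matrix (Fin n) (Fin n) ℝ) (B : Matrix (Fin n) (Fin m) ℝ)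
    (Q : Matrix (Fin n) (Fin n) ℝ) (R : Matrix (Fin m) (Fin m) ℝ)
    (Sig : Matrix (Fin n) (Fin n) ℝ) (hQ : Q.PosDef) (hR : R.PosDef) (hSig : Sig.PosDef)
    (μ : Measure (Fin n → ℝ)) (hμ : IsInitialLaw μ Sig)
    (K₀ : Matrix (Fin m) (Fin n) ℝ) (hK₀ : K₀ ∈ stabilizingGains A B)
    (d : ℝ) (hd : 0 < d) :
    (∀ K ∈ stabilizingGains A B, DifferentiableAt ℝ (slqrCost A B Q R μ) K) ∧
    ∃ Ks ∈ stabilizingGains A B,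
      (∀ K ∈ stabilizingGains A B, ∇ (slqrCost A B Q R μ) K = 0 ↔ K = Ks) ∧
      (∀ K ∈ stabilizingGains A B, slqrCost A B Q R μ Ks ≤ slqrCost A B Q R μ K) ∧
      ∃ φ : ℝ → Matrix (Fin m) (Fin n) ℝ × Matrix (Fin m) (Fin n) ℝ →
          Matrix (Fin m) (Fin n) ℝ × Matrix (Fin m) (Fin n) ℝ,
        IsForwardFlow (heavyBallField (slqrCost A B Q R μ) d 0) (stabilizingGains A B ×ˢ univ) φ ∧
        IsLyapunovAsymptoticallyStable (stabilizingGains A B ×ˢ univ) φ (Ks, 0) ∧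
        slqrSublevel A B Q R μ K₀ ×ˢ univ ⊆
          regionOfAttraction (stabilizingGains A B ×ˢ univ) φ (Ks, 0) := by
  have hS := isOpen_stabilizingGains A B
  have hgrad : ∀ K ∈ stabilizingGains A B, HasGradientAt (slqrCost A B Q R μ)
      (∇ (slqrCost A B Q R μ) K) K := fun K hK =>
    (hasGradientAt_slqrCost hQ hR hSig hμ hK).differentiableAt.hasGradientAt
  have hgrad_eq : ∀ K ∈ stabilizingGains A B, ∇ (slqrCost A B Q R μ) K =
      (2 : ℝ) • (gainResidual A B Q R K * gramian A B Sig K) := fun K hK =>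
    (hasGradientAt_slqrCost hQ hR hSig hμ hK).gradient
  have hcomp := isCompact_slqrCost_sublevel (A := A) (B := B) hQ hR hSig hμ
  refine ⟨fun K hK => (hgrad K hK).differentiableAt, ?_⟩
  obtain ⟨Ks, ⟨hKs, hKs₀⟩, hKsmin⟩ := (hcomp (slqrCost A B Q R μ K₀)).exists_isMinOn
    ⟨K₀, hK₀, le_rfl⟩ (f := slqrCost A B Q R μ)
    fun K hK => (hgrad K hK.1).continuousAt.continuousWithinAt
  have hle : ∀ K ∈ stabilizingGains A B, slqrCost A B Q R μ Ks ≤ slqrCost A B Q R μ K := by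
    intro K hK
    rcases le_total (slqrCost A B Q R μ K) (slqrCost A B Q R μ K₀) with h | h
    exacts [hKsmin ⟨hK, h⟩, hKs₀.trans h]
  have hstat : ∇ (slqrCost A B Q R μ) Ks = 0 := by
    have hloc : IsLocalMin (slqrCost A B Q R μ) Ks := by
      filter_upwards [hS.mem_nhds hKs] with K hK using hle K hK
    rw [gradient, hloc.fderiv_eq_zero, map_zero]
  have hlt : ∀ K ∈ stabilizingGains A B, ∇ (slqrCost A B Q R μ) K = 0 →
      ∀ L ∈ stabilizingGains A B, L ≠ K → slqrCost A B Q R μ K < slqrCost A B Q R μ L := by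
    intro K hK h0 L hL hne
    rw [hgrad_eq K hK] at h0
    exact slqrCost_lt_of_gainResidual_eq_zero hQ hR hSig hμ hK hL
      (gainResidual_eq_zero_of_gradient_eq_zero hSig hK h0) hne
  have hunique : ∀ K ∈ stabilizingGains A B, ∇ (slqrCost A B Q R μ) K = 0 → K = Ks := by
    intro K hK h0
    by_contra hne
    exact absurd (hlt K hK h0 Ks hKs (Ne.symm hne)) (not_lt.2 (hle K hK))
  have hsmooth : ContDiffOn ℝ 1 (∇ (slqrCost A B Q R μ)) (stabilizingGains A B) := fun K hK =>
    ((contDiffAt_gradient hK).congr_of_eventuallyEq (by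
      filter_upwards [hS.mem_nhds hK] with L hL using hgrad_eq L hL)).contDiffWithinAt
  obtain ⟨φ, hφ, hstab, hattr⟩ := exists_heavyBall_flow hS hgrad hsmooth hcomp hKs hunique
    (hlt Ks hKs hstat) hd
  have hfield : heavyBallField (slqrCost A B Q R μ) d 0 =
      fun z => (z.2, -∇ (slqrCost A B Q R μ) z.1 - (2 * d) • z.2) := by
    funext z
    rw [heavyBallField, zero_smul, add_zero, sub_self, sub_zero, ← sub_eq_add_neg]
  refine ⟨Ks, hKs, fun K hK => ⟨hunique K hK, ?_⟩, hle, φ, ?_, hstab, ?_⟩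
  · rintro rfl
    exact hstat
  · rw [hfield]
    exact hφ
  · exact (prod_mono_left fun K hK => hK.1).trans hattr
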